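/- Work over a field $k$. A *cogroupoid* $\mathcal C$ consists of a set of objects, $k$-algebras $\mathcal C(X,Y)$, algebra homomorphisms $\Delta^Z_{X,Y}:\mathcal C(X,Y)\to\mathcal C(X,Z)\otimes\mathcal C(Z,Y)$ and $\varepsilon_X:\mathcal C(X,X)\to k$ that are coassociative and counital, and linear maps $S_{X,Y}:\mathcal C(X,Y)\to\mathcal C(Y,X)$ such that $S_{X,Y}(a_1^{X,Y})a_2^{Y,X}=\varepsilon_X(a)1$ and $a_1^{X,Y}S_{Y,X}(a_2^{Y,X})=\varepsilon_X(a)1$ for $a\in\mathcal C(X,X)$; it is *connected* if every $\mathcal C(X,Y)$ is nonzero. Each $\mathcal C(X,X)$ is then a Hopf algebra. For a Hopf algebra $H$, a (right-right) *Yetter–Drinfeld module* is a right $H$-module and right $H$-comodule $V$ with $\delta(v\cdot h)=v_{(0)}\cdot h_2\otimes S(h_1)v_{(1)}h_3$; morphisms are the $H$-linear and $H$-colinear maps. The trivial one is $k$, with $x\cdot h=\varepsilon(h)x$ and $\delta(x)=x\otimes 1$. For a right $H$-comodule $V$, the *free* Yetter–Drinfeld module $V\boxtimes H$ is $V\otimes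 H$ with $(v\otimes h)\cdot g=v\otimes hg$ and $\delta(v\otimes h)=v_{(0)}\otimes h_2\otimes S(h_1)v_{(1)}h_3$. A Yetter–Drinfeld module $P$ is *relative projective* if $\operatorname{Hom}(P,-)$ sends short exact sequences of Yetter–Drinfeld modules that split as sequences of comodules to exact sequences of vector spaces; a relative projective $P$ is *finitely generated* if it is a direct summand of some $V\boxtimes H$ with $V$ finite dimensional. A *relative projective Yetter–Drinfeld resolution* of $M$ is a complex $\cdots\to P_1\to P_0\to 0$ of relative projective Yetter–Drinfeld modules for which there is a morphism $\epsilon:P_0\to M$ with $\cdots\to P_1\to P_0\xrightarrow{\epsilon}M\to0$ exact; it is *finitely generated* if every $P_i$ is, and *bounded* if $P_i=0$ for all large $i$. **Lemma.** Let $\mathcal C$ be a connected cogroupoid and $X,Y$ objects of $\mathcal C$. Consider the functor $-\square_{\mathcal C(X,X)}\mathcal C(X,Y)$ from Yetter–Drinfeld modules over $\mathcal C(X,X)$ to Yetter–Drinfeld modules over $\mathcal C(Y,Y)$, where $V\square_{\mathcal C(X,X)}\mathcal C(X,Y)\subseteq V\otimes\mathcal C(X,Y)$ is the equalizer of $\delta_V\otimes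 1$ and $1\otimes\Delta^X_{X,Y}$, with action $(v\otimes a)\cdot b=v\cdot b_2^{X,X}\otimes S_{Y,X}(b_1^{Y,X})\,a\,b_3^{X,Y}$ and coaction $1\otimes\Delta^Y_{X,Y}$. If $P_*$ is a relative projective Yetter–Drinfeld resolution of the trivial Yetter–Drinfeld module $k$ over $\mathcal C(X,X)$, then $P_*\square_{\mathcal C(X,X)}\mathcal C(X,Y)$ is a relative projective Yetter–Drinfeld resolution of the trivial Yetter–Drinfeld module $k$ over $\mathcal C(Y,Y)$. If $P_*$ is finitely generated (resp. bounded), then so is $P_*\square_{\mathcal C(X,X)}\mathcal C(X,Y)$. -/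

import Mathlib

open scoped TensorProduct
open CategoryTheory

set_option linter.unusedSimpArgs false

universe u

namespace YetterDrinfeld

section Sandwich

variable {k : Type*} [Field k]
  {V W W' A B D L A₁ A₂ D₁ D₂ : Type*}
  [AddCommGroup V] [Module k V] [AddCommGroup W] [Module k W] [AddCommGroup W'] [Module k W']
  [Ring A] [Algebra k A] [Ring B] [Algebra k B] [Ring D] [Algebra k D]
  [Ring A₁] [Algebra k A₁] [Ring A₂] [Algebra k A₂] [Ring D₁] [Algebra k D₁]
  [Ring D₂] [Algebra k D₂]
  {M N : Type*} [AddCommGroup M] [Module k M] [AddCommGroup N] [Module k N]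

/-- Given a bilinear map `α : V × B → W` and a linear map `σ : A → D`, the bilinear map
`(v ⊗ d, a ⊗ b ⊗ c) ↦ α(v, b) ⊗ σ(a) d c`. -/
noncomputable def sandwich (α : V →ₗ[k] M →ₗ[k] W) (σ : N →ₗ[k] D) :
    V ⊗[k] D →ₗ[k] (N ⊗[k] (M ⊗[k] D)) →ₗ[k] W ⊗[k] D :=
  TensorProduct.lift (LinearMap.mk₂ k
    (fun v d =>
      TensorProduct.map (α v)
          (LinearMap.mul' k D ∘ₗ
            TensorProduct.map (LinearMap.mulRight k d ∘ₗ σ) LinearMap.id) ∘ₗ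
        (TensorProduct.leftComm k N M D).toLinearMap)
    (fun v v' d => by ext; simp [TensorProduct.add_tmul])
    (fun c v d => by ext; simp [TensorProduct.smul_tmul'])
    (fun v d d' => by ext; simp [mul_add, add_mul, TensorProduct.tmul_add])
    (fun c v d => by ext; simp))

@[simp]
theorem sandwich_tmul (α : V →ₗ[k] M →ₗ[k] W) (σ : N →ₗ[k] D) (v : V) (d : D) (a : N) (b : M)
    (c : D) :
    sandwich α σ (v ⊗ₜ d) (a ⊗ₜ (b ⊗ₜ c)) = α v b ⊗ₜ[k] (σ a * d * c) := by
  simp [sandwich]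

theorem sandwich_mul (α : V →ₗ[k] B →ₗ[k] W) (β : W →ₗ[k] B →ₗ[k] W') (γ : V →ₗ[k] B →ₗ[k] W')
    (σ : A →ₗ[k] D) (h : ∀ v b b', β (α v b) b' = γ v (b * b'))
    (hσ : ∀ a a', σ (a * a') = σ a' * σ a) (x : V ⊗[k] D) (t t' : A ⊗[k] (B ⊗[k] D)) :
    sandwich β σ (sandwich α σ x t) t' = sandwich γ σ x (t * t') := by
  induction x with
  | zero => simp only [LinearMap.map_zero, LinearEquiv.map_zero, LinearMap.zero_apply, TensorProduct.zero_tmul, TensorProduct.tmul_zero, mul_zero, zero_mul]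
  | add x y hx hy => simp [hx, hy]
  | tmul v d =>
    induction t with
    | zero => simp only [LinearMap.map_zero, LinearEquiv.map_zero, LinearMap.zero_apply, TensorProduct.zero_tmul, TensorProduct.tmul_zero, mul_zero, zero_mul]
    | add x y hx hy => simp only [LinearMap.map_add, LinearEquiv.map_add, LinearMap.add_apply, hx, hy, add_mul]
    | tmul a t =>
      induction t with
      | zero => simp only [LinearMap.map_zero, LinearEquiv.map_zero, LinearMap.zero_apply, TensorProduct.zero_tmul, TensorProduct.tmul_zero, mul_zero, zero_mul]
      | add x y hx hy =>
        simp only [LinearMap.map_add, LinearEquiv.map_add, LinearMap.add_apply, hx, hy, add_mul, TensorProduct.tmul_add]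
      | tmul b c =>
        induction t' with
        | zero => simp only [LinearMap.map_zero, LinearEquiv.map_zero, LinearMap.zero_apply, TensorProduct.zero_tmul, TensorProduct.tmul_zero, mul_zero, zero_mul]
        | add x y hx hy => simp only [LinearMap.map_add, LinearEquiv.map_add, hx, hy, mul_add]
        | tmul a' t' =>
          induction t' with
          | zero => simp only [LinearMap.map_zero, LinearEquiv.map_zero, LinearMap.zero_apply, TensorProduct.zero_tmul, TensorProduct.tmul_zero, mul_zero, zero_mul]
          | add x y hx hy => simp only [LinearMap.map_add, LinearEquiv.map_add, hx, hy, mul_add, TensorProduct.tmul_add]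
          | tmul b' c' => simp [h, hσ, mul_assoc]

theorem sandwich_one (α : V →ₗ[k] B →ₗ[k] V) (σ : A →ₗ[k] D) (h : ∀ v, α v 1 = v)
    (hσ : σ 1 = 1) (x : V ⊗[k] D) : sandwich α σ x 1 = x := by
  induction x with
  | zero => simp only [LinearMap.map_zero, LinearEquiv.map_zero, LinearMap.zero_apply, TensorProduct.zero_tmul, TensorProduct.tmul_zero, mul_zero, zero_mul]
  | add x y hx hy => simp [hx, hy]
  | tmul v d => simp [Algebra.TensorProduct.one_def, h, hσ]

/-- `(a₁ ⊗ a₂) ⊗ b ⊗ d₂ ⊗ d₁ ↦ a₁ ⊗ (a₂ ⊗ b ⊗ d₂) ⊗ d₁`. -/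
noncomputable def regroup (k A₁ A₂ B D₂ D₁ : Type*) [Field k] [AddCommGroup A₁] [Module k A₁]
    [AddCommGroup A₂] [Module k A₂] [AddCommGroup B] [Module k B] [AddCommGroup D₁] [Module k D₁]
    [AddCommGroup D₂] [Module k D₂] :
    (A₁ ⊗[k] A₂) ⊗[k] (B ⊗[k] (D₂ ⊗[k] D₁)) →ₗ[k]
      A₁ ⊗[k] ((A₂ ⊗[k] (B ⊗[k] D₂)) ⊗[k] D₁) :=
  (((TensorProduct.assoc k A₂ (B ⊗[k] D₂) D₁).symm.toLinearMap ∘ₗ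
      (TensorProduct.assoc k B D₂ D₁).symm.toLinearMap.lTensor A₂).lTensor A₁) ∘ₗ
    (TensorProduct.assoc k A₁ A₂ (B ⊗[k] (D₂ ⊗[k] D₁))).toLinearMap

@[simp]
theorem regroup_tmul (k : Type*) {A₁ A₂ B D₂ D₁ : Type*} [Field k] [AddCommGroup A₁] [Module k A₁]
    [AddCommGroup A₂] [Module k A₂] [AddCommGroup B] [Module k B] [AddCommGroup D₁] [Module k D₁]
    [AddCommGroup D₂] [Module k D₂] (a₁ : A₁) (a₂ : A₂) (b : B) (d₂ : D₂) (d₁ : D₁) :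
    regroup k A₁ A₂ B D₂ D₁ ((a₁ ⊗ₜ a₂) ⊗ₜ (b ⊗ₜ (d₂ ⊗ₜ d₁))) =
      a₁ ⊗ₜ ((a₂ ⊗ₜ (b ⊗ₜ d₂)) ⊗ₜ d₁) := by
  simp [regroup]

theorem sandwich_comul (α : V →ₗ[k] M →ₗ[k] W) (σ : N →ₗ[k] D) (δ : D →ₐ[k] D₂ ⊗[k] D₁)
    (δ' : N →ₗ[k] A₁ ⊗[k] A₂) (σ₁ : A₁ →ₗ[k] D₁) (σ₂ : A₂ →ₗ[k] D₂)
    (h : ∀ a, δ (σ a) = TensorProduct.comm k D₁ D₂ (TensorProduct.map σ₁ σ₂ (δ' a)))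
    (x : V ⊗[k] D) (t : N ⊗[k] (M ⊗[k] D)) :
    (TensorProduct.assoc k W D₂ D₁).symm (δ.toLinearMap.lTensor W (sandwich α σ x t)) =
      sandwich (sandwich α σ₂) σ₁
        ((TensorProduct.assoc k V D₂ D₁).symm (δ.toLinearMap.lTensor V x))
        (regroup k A₁ A₂ M D₂ D₁
          (TensorProduct.map δ' (TensorProduct.map LinearMap.id δ.toLinearMap) t)) := by
  induction x with
  | zero => simp only [LinearMap.map_zero, LinearEquiv.map_zero, LinearMap.zero_apply, TensorProduct.zero_tmul, TensorProduct.tmul_zero, mul_zero, zero_mul]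
  | add x y hx hy => simp only [LinearMap.map_add, LinearEquiv.map_add, LinearMap.add_apply, hx, hy]
  | tmul v d =>
    induction t with
    | zero => simp only [LinearMap.map_zero, LinearEquiv.map_zero, LinearMap.zero_apply, TensorProduct.zero_tmul, TensorProduct.tmul_zero, mul_zero, zero_mul]
    | add x y hx hy => simp only [LinearMap.map_add, LinearEquiv.map_add, hx, hy]
    | tmul a t =>
      induction t with
      | zero => simp only [LinearMap.map_zero, LinearEquiv.map_zero, LinearMap.zero_apply, TensorProduct.zero_tmul, TensorProduct.tmul_zero, mul_zero, zero_mul]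
      | add x y hx hy => simp only [LinearMap.map_add, LinearEquiv.map_add, hx, hy, TensorProduct.tmul_add]
      | tmul b c =>
        simp only [sandwich_tmul, LinearMap.lTensor_tmul, AlgHom.toLinearMap_apply, map_mul, h,
          TensorProduct.map_tmul, LinearMap.id_apply]
        generalize δ d = y
        generalize δ c = z
        generalize δ' a = w
        induction w with
        | zero => simp only [LinearMap.map_zero, LinearEquiv.map_zero, LinearMap.zero_apply, TensorProduct.zero_tmul, TensorProduct.tmul_zero, mul_zero, zero_mul]
        | add w w' hw hw' =>
          simp only [LinearMap.map_add, LinearEquiv.map_add, TensorProduct.add_tmul, TensorProduct.tmul_add, add_mul, hw, hw']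
        | tmul a₁ a₂ =>
          induction y with
          | zero => simp only [LinearMap.map_zero, LinearEquiv.map_zero, LinearMap.zero_apply, TensorProduct.zero_tmul, TensorProduct.tmul_zero, mul_zero, zero_mul]
          | add w w' hw hw' =>
            simp only [LinearMap.map_add, LinearEquiv.map_add, TensorProduct.tmul_add, add_mul, mul_add, hw, hw',
              LinearMap.add_apply]
          | tmul y₂ y₁ =>
            induction z with
            | zero => simp only [LinearMap.map_zero, LinearEquiv.map_zero, LinearMap.zero_apply, TensorProduct.zero_tmul, TensorProduct.tmul_zero, mul_zero, zero_mul]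
            | add w w' hw hw' =>
              simp only [LinearMap.map_add, LinearEquiv.map_add, TensorProduct.tmul_add, mul_add, hw, hw']
            | tmul z₂ z₁ => simp

theorem sandwich_map (α : V →ₗ[k] M →ₗ[k] W) (σ : N →ₗ[k] D) {V' M' : Type*} [AddCommGroup V']
    [Module k V'] [AddCommGroup M'] [Module k M'] (α' : V' →ₗ[k] M' →ₗ[k] W')
    (f : V →ₗ[k] V') (g : W →ₗ[k] W') (p : M →ₗ[k] M')
    (h : ∀ v m, g (α v m) = α' (f v) (p m)) (x : V ⊗[k] D) (t : N ⊗[k] (M ⊗[k] D)) :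
    g.rTensor D (sandwich α σ x t) =
      sandwich α' σ (f.rTensor D x) (TensorProduct.map LinearMap.id
        (TensorProduct.map p LinearMap.id) t) := by
  induction x with
  | zero => simp only [LinearMap.map_zero, LinearEquiv.map_zero, LinearMap.zero_apply, TensorProduct.zero_tmul, TensorProduct.tmul_zero, mul_zero, zero_mul]
  | add x y hx hy => simp only [LinearMap.map_add, LinearEquiv.map_add, LinearMap.add_apply, hx, hy]
  | tmul v d =>
    induction t with
    | zero => simp only [LinearMap.map_zero, LinearEquiv.map_zero, LinearMap.zero_apply, TensorProduct.zero_tmul, TensorProduct.tmul_zero, mul_zero, zero_mul]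
    | add x y hx hy => simp only [LinearMap.map_add, LinearEquiv.map_add, hx, hy]
    | tmul a t =>
      induction t with
      | zero => simp only [LinearMap.map_zero, LinearEquiv.map_zero, LinearMap.zero_apply, TensorProduct.zero_tmul, TensorProduct.tmul_zero, mul_zero, zero_mul]
      | add x y hx hy => simp only [LinearMap.map_add, LinearEquiv.map_add, hx, hy, TensorProduct.tmul_add]
      | tmul b c => simp [h]

end Sandwich


/-- A cogroupoid over `k` with set of objects `Ob`: algebras `C(X,Y)`, algebra homomorphisms
`Δ^Z_{X,Y} : C(X,Y) → C(X,Z) ⊗ C(Z,Y)` and `ε_X : C(X,X) → k`, and linear maps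
`S_{X,Y} : C(X,Y) → C(Y,X)`, subject to coassociativity, the counit axioms and the two antipode
axioms. -/
structure Cogroupoid (k : Type u) [Field k] (Ob : Type*) where
  /-- The algebra `C(X,Y)`. -/
  alg : Ob → Ob → Type u
  [ring : ∀ X Y, Ring (alg X Y)]
  [algebra : ∀ X Y, Algebra k (alg X Y)]
  /-- The comultiplication `Δ^Z_{X,Y}`, written `comul X Z Y`. -/
  comul : ∀ X Z Y, alg X Y →ₐ[k] alg X Z ⊗[k] alg Z Y
  /-- The counit `ε_X`. -/
  counit : ∀ X, alg X X →ₐ[k] k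
  /-- The antipode `S_{X,Y}`. -/
  S : ∀ X Y, alg X Y →ₗ[k] alg Y X
  coassoc : ∀ X T Z Y (a : alg X Y),
    TensorProduct.assoc k (alg X T) (alg T Z) (alg Z Y)
        ((comul X T Z).toLinearMap.rTensor (alg Z Y) (comul X Z Y a)) =
      (comul T Z Y).toLinearMap.lTensor (alg X T) (comul X T Y a)
  counit_comul : ∀ X Y (a : alg X Y),
    TensorProduct.lid k (alg X Y) ((counit X).toLinearMap.rTensor (alg X Y) (comul X X Y a)) = a
  comul_counit : ∀ X Y (a : alg X Y),
    TensorProduct.rid k (alg X Y) ((counit Y).toLinearMap.lTensor (alg X Y) (comul X Y Y a)) = a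
  mul_S : ∀ X Y (a : alg X X),
    LinearMap.mul' k (alg X Y) ((S Y X).lTensor (alg X Y) (comul X Y X a)) =
      algebraMap k (alg X Y) (counit X a)
  S_mul : ∀ X Y (a : alg X X),
    LinearMap.mul' k (alg Y X) ((S X Y).rTensor (alg Y X) (comul X Y X a)) =
      algebraMap k (alg Y X) (counit X a)

namespace Cogroupoid

attribute [instance] Cogroupoid.ring Cogroupoid.algebra

section

variable {k : Type u} [Field k] {Ob : Type*} (C : Cogroupoid k Ob)

/-- A cogroupoid is connected if all its algebras are nonzero. -/
def Connected : Prop := ∀ X Y, Nontrivial (C.alg X Y)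

/-- The Hopf algebra `C(X,X)`. -/
noncomputable instance hopfAlgebra (X : Ob) : HopfAlgebra k (C.alg X X) where
  __ := Bialgebra.ofAlgHom (C.comul X X X) (C.counit X)
    (by ext a; exact C.coassoc X X X X a)
    (by
      ext a
      apply (TensorProduct.lid k (C.alg X X)).injective
      exact (C.counit_comul X X a).trans (by simp))
    (by
      ext a
      apply (TensorProduct.rid k (C.alg X X)).injective
      exact (C.comul_counit X X a).trans (by simp))
  antipode := C.S X X
  mul_antipode_rTensor_comul := by ext a; exact C.S_mul X X a
  mul_antipode_lTensor_comul := by ext a; exact C.mul_S X X a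

/-- A Hopf algebra is a cogroupoid with one object. -/
noncomputable def ofHopf (k H : Type u) [Field k] [Ring H] [HopfAlgebra k H] :
    Cogroupoid k PUnit.{1} where
  alg _ _ := H
  comul _ _ _ := Bialgebra.comulAlgHom k H
  counit _ := Bialgebra.counitAlgHom k H
  S _ _ := HopfAlgebra.antipode k
  coassoc _ _ _ _ a := Coalgebra.coassoc_apply a
  counit_comul _ _ a := by
    have := Coalgebra.rTensor_counit_comul (R := k) a
    exact (congrArg (TensorProduct.lid k H) this).trans (by simp)
  comul_counit _ _ a := by
    have := Coalgebra.lTensor_counit_comul (R := k) a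
    exact (congrArg (TensorProduct.rid k H) this).trans (by simp)
  mul_S _ _ a := HopfAlgebra.mul_antipode_lTensor_comul_apply a
  S_mul _ _ a := HopfAlgebra.mul_antipode_rTensor_comul_apply a

/-- The iterated comultiplication `C(X,Y) → C(X,Z) ⊗ C(Z,W) ⊗ C(W,Y)`. -/
noncomputable def comul₃ (X Z W Y : Ob) :
    C.alg X Y →ₐ[k] C.alg X Z ⊗[k] (C.alg Z W ⊗[k] C.alg W Y) :=
  (Algebra.TensorProduct.map (AlgHom.id k _) (C.comul Z W Y)).comp (C.comul X Z Y)

theorem comul₃_apply (X Z W Y : Ob) (a : C.alg X Y) :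
    C.comul₃ X Z W Y a = (C.comul Z W Y).toLinearMap.lTensor _ (C.comul X Z Y a) := rfl

theorem S_one (X Y : Ob) : C.S X Y 1 = 1 := by
  simpa [Algebra.TensorProduct.one_def] using C.S_mul X Y 1

end

end Cogroupoid

/-- Uniqueness of convolution inverses. -/
theorem conv_unique {k : Type*} [Field k] {P Q E F B : Type*} [AddCommGroup P] [Module k P]
    [AddCommGroup Q] [Module k Q] [AddCommGroup E] [Module k E] [AddCommGroup F] [Module k F]
    [Ring B] [Algebra k B] (c₁ : P →ₗ[k] E ⊗[k] P) (c₂ : P →ₗ[k] P ⊗[k] F)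
    (d₁ : E →ₗ[k] P ⊗[k] Q) (d₂ : F →ₗ[k] Q ⊗[k] P) (e : E →ₗ[k] k) (f : F →ₗ[k] k)
    (hco : ∀ p, TensorProduct.assoc k P Q P (d₁.rTensor P (c₁ p)) = d₂.lTensor P (c₂ p))
    (he : ∀ p, TensorProduct.lid k P (e.rTensor P (c₁ p)) = p)
    (hf : ∀ p, TensorProduct.rid k P (f.lTensor P (c₂ p)) = p)
    (φ ψ : P →ₗ[k] B) (m : Q →ₗ[k] B)
    (hφ : ∀ x, LinearMap.mul' k B (TensorProduct.map φ m (d₁ x)) = algebraMap k B (e x))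
    (hψ : ∀ x, LinearMap.mul' k B (TensorProduct.map m ψ (d₂ x)) = algebraMap k B (f x)) :
    φ = ψ := by
  ext p
  let Θ : P ⊗[k] (Q ⊗[k] P) →ₗ[k] B := LinearMap.mul' k B ∘ₗ
    TensorProduct.map φ (LinearMap.mul' k B ∘ₗ TensorProduct.map m ψ)
  have h1 : ∀ t : E ⊗[k] P, Θ (TensorProduct.assoc k P Q P (d₁.rTensor P t)) =
      ψ (TensorProduct.lid k P (e.rTensor P t)) := by
    intro t
    induction t with
    | zero => simp only [LinearMap.map_zero, LinearEquiv.map_zero, LinearMap.zero_apply, TensorProduct.zero_tmul, TensorProduct.tmul_zero, mul_zero, zero_mul]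
    | add x y hx hy => simp only [LinearMap.map_add, LinearEquiv.map_add, hx, hy]
    | tmul x p =>
      have : ∀ s : P ⊗[k] Q, Θ (TensorProduct.assoc k P Q P (s ⊗ₜ p)) =
          LinearMap.mul' k B (TensorProduct.map φ m s) * ψ p := by
        intro s
        induction s with
        | zero => simp only [LinearMap.map_zero, LinearEquiv.map_zero, LinearMap.zero_apply, TensorProduct.zero_tmul, TensorProduct.tmul_zero, mul_zero, zero_mul]
        | add x y hx hy => simp only [LinearMap.map_add, LinearEquiv.map_add, TensorProduct.add_tmul, hx, hy, add_mul]
        | tmul a b => simp [Θ, mul_assoc]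
      simp [this, hφ, Algebra.smul_def]
  have h2 : ∀ t : P ⊗[k] F, Θ (d₂.lTensor P t) =
      φ (TensorProduct.rid k P (f.lTensor P t)) := by
    intro t
    induction t with
    | zero => simp only [LinearMap.map_zero, LinearEquiv.map_zero, LinearMap.zero_apply, TensorProduct.zero_tmul, TensorProduct.tmul_zero, mul_zero, zero_mul]
    | add x y hx hy => simp only [LinearMap.map_add, LinearEquiv.map_add, hx, hy]
    | tmul p x =>
      simp [Θ, hψ, Algebra.smul_def, Algebra.commutes]
  have h3 := h2 (c₂ p)
  rw [hf, ← hco, h1, he] at h3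
  exact h3.symm

section TensorSquare

variable {k : Type*} [Field k] {E F P Q : Type*} [AddCommGroup E] [Module k E]
  [AddCommGroup F] [Module k F] [AddCommGroup P] [Module k P] [AddCommGroup Q] [Module k Q]

/-- The tensor square of a map `d : E → P ⊗ Q`. -/
noncomputable def sq (d : E →ₗ[k] P ⊗[k] Q) : E ⊗[k] E →ₗ[k] (P ⊗[k] P) ⊗[k] (Q ⊗[k] Q) :=
  (TensorProduct.tensorTensorTensorComm k P Q P Q).toLinearMap ∘ₗ TensorProduct.map d d

theorem sq_tmul (d : E →ₗ[k] P ⊗[k] Q) (a b : E) :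
    sq d (a ⊗ₜ b) = TensorProduct.tensorTensorTensorComm k P Q P Q (d a ⊗ₜ d b) := by
  simp [sq]

theorem sq_assoc_left (d : E →ₗ[k] P ⊗[k] Q) (s t : E ⊗[k] F) :
    TensorProduct.assoc k _ _ _
        ((sq d).rTensor _ (TensorProduct.tensorTensorTensorComm k _ _ _ _ (s ⊗ₜ t))) =
      (TensorProduct.tensorTensorTensorComm k Q F Q F).toLinearMap.lTensor _
        (TensorProduct.tensorTensorTensorComm k _ _ _ _
          (TensorProduct.assoc k _ _ _ (d.rTensor _ s) ⊗ₜ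
            TensorProduct.assoc k _ _ _ (d.rTensor _ t))) := by
  induction s with
  | zero => simp only [TensorProduct.zero_tmul, LinearMap.map_zero, LinearEquiv.map_zero]
  | add x y hx hy => simp only [LinearMap.map_add, LinearEquiv.map_add, TensorProduct.add_tmul, hx, hy]
  | tmul s s' =>
  induction t with
  | zero => simp only [TensorProduct.tmul_zero, LinearMap.map_zero, LinearEquiv.map_zero]
  | add x y hx hy => simp only [LinearMap.map_add, LinearEquiv.map_add, TensorProduct.tmul_add, hx, hy]
  | tmul t t' =>
  simp only [TensorProduct.tensorTensorTensorComm_tmul, LinearMap.rTensor_tmul, sq_tmul]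
  generalize d s = x
  generalize d t = y
  induction x with
  | zero => simp only [TensorProduct.zero_tmul, LinearMap.map_zero, LinearEquiv.map_zero]
  | add x y hx hy => simp only [LinearMap.map_add, LinearEquiv.map_add, TensorProduct.add_tmul, hx, hy]
  | tmul x x' =>
  induction y with
  | zero => simp only [TensorProduct.zero_tmul, TensorProduct.tmul_zero, LinearMap.map_zero, LinearEquiv.map_zero]
  | add x y hx hy =>
    simp only [LinearMap.map_add, LinearEquiv.map_add, TensorProduct.add_tmul, TensorProduct.tmul_add, hx, hy]
  | tmul y y' => simp

theorem sq_assoc_right (d : E →ₗ[k] P ⊗[k] Q) (s t : F ⊗[k] E) :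
    (sq d).lTensor _ (TensorProduct.tensorTensorTensorComm k _ _ _ _ (s ⊗ₜ t)) =
      (TensorProduct.tensorTensorTensorComm k P Q P Q).toLinearMap.lTensor _
        (TensorProduct.tensorTensorTensorComm k _ _ _ _ (d.lTensor _ s ⊗ₜ d.lTensor _ t)) := by
  induction s with
  | zero => simp only [TensorProduct.zero_tmul, LinearMap.map_zero, LinearEquiv.map_zero]
  | add x y hx hy => simp only [LinearMap.map_add, LinearEquiv.map_add, TensorProduct.add_tmul, hx, hy]
  | tmul s s' =>
  induction t with
  | zero => simp only [TensorProduct.tmul_zero, LinearMap.map_zero, LinearEquiv.map_zero]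
  | add x y hx hy => simp only [LinearMap.map_add, LinearEquiv.map_add, TensorProduct.tmul_add, hx, hy]
  | tmul t t' => simp [sq_tmul]

theorem sq_coassoc (c₁ : P →ₗ[k] E ⊗[k] P) (c₂ : P →ₗ[k] P ⊗[k] F) (d₁ : E →ₗ[k] P ⊗[k] Q)
    (d₂ : F →ₗ[k] Q ⊗[k] P)
    (hco : ∀ p, TensorProduct.assoc k P Q P (d₁.rTensor P (c₁ p)) = d₂.lTensor P (c₂ p))
    (p : P ⊗[k] P) :
    TensorProduct.assoc k _ _ _ ((sq d₁).rTensor _ (sq c₁ p)) = (sq d₂).lTensor _ (sq c₂ p) := by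
  induction p with
  | zero => simp only [LinearMap.map_zero, LinearEquiv.map_zero]
  | add x y hx hy => simp only [LinearMap.map_add, LinearEquiv.map_add, hx, hy]
  | tmul a b => rw [sq_tmul, sq_tmul, sq_assoc_left, sq_assoc_right, hco, hco]

end TensorSquare

namespace Cogroupoid

section

variable {k : Type u} [Field k] {Ob : Type*} (C : Cogroupoid k Ob)

/-- The two ways of computing the fivefold comultiplication
`C(X,Y) → C(X,P) ⊗ (C(P,Z) ⊗ C(Z,W) ⊗ C(W,Q)) ⊗ C(Q,Y)` agree. -/
theorem five (X P Z W Q Y : Ob) (a : C.alg X Y) :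
    regroup k _ _ _ _ _ (TensorProduct.map (C.comul X P Z).toLinearMap
        (TensorProduct.map LinearMap.id (C.comul W Q Y).toLinearMap) (C.comul₃ X Z W Y a)) =
      TensorProduct.map LinearMap.id
        (TensorProduct.map (C.comul₃ P Z W Q).toLinearMap LinearMap.id) (C.comul₃ X P Q Y a) := by
  have key : ∀ c : C.alg P Y,
      (TensorProduct.assoc k _ _ _).symm
        (((C.comul Z W Q).toLinearMap.rTensor _ ∘ₗ (C.comul Z Q Y).toLinearMap).lTensor _
          (C.comul P Z Y c)) =
      (C.comul₃ P Z W Q).toLinearMap.rTensor _ (C.comul P Q Y c) := by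
    intro c
    rw [LinearMap.lTensor_comp, LinearMap.comp_apply, ← C.coassoc P Z Q Y c]
    generalize C.comul P Q Y c = t
    induction t with
    | zero => simp only [LinearMap.map_zero, LinearEquiv.map_zero, LinearMap.zero_apply, TensorProduct.zero_tmul, TensorProduct.tmul_zero, mul_zero, zero_mul]
    | add x y hx hy => simp only [LinearMap.map_add, LinearEquiv.map_add, hx, hy]
    | tmul u v =>
      simp only [LinearMap.rTensor_tmul, AlgHom.toLinearMap_apply, comul₃_apply]
      generalize C.comul P Z Q u = s
      induction s with
      | zero => simp only [LinearMap.map_zero, LinearEquiv.map_zero, LinearMap.zero_apply, TensorProduct.zero_tmul, TensorProduct.tmul_zero, mul_zero, zero_mul]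
      | add x y hx hy => simp only [LinearMap.map_add, LinearEquiv.map_add, TensorProduct.add_tmul, hx, hy]
      | tmul p q => 
        simp only [TensorProduct.assoc_tmul, LinearMap.lTensor_tmul, LinearMap.rTensor_tmul,
          AlgHom.toLinearMap_apply]
        generalize C.comul Z W Q q = s
        induction s with
        | zero => simp only [LinearMap.map_zero, LinearEquiv.map_zero, LinearMap.zero_apply, TensorProduct.zero_tmul, TensorProduct.tmul_zero, mul_zero, zero_mul]
        | add x y hx hy => simp only [LinearMap.map_add, LinearEquiv.map_add, TensorProduct.add_tmul, TensorProduct.tmul_add, hx, hy]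
        | tmul p q => simp
  have key2 : ∀ t : C.alg X Z ⊗[k] C.alg Z Y,
      regroup k _ _ _ _ _ (TensorProduct.map (C.comul X P Z).toLinearMap
        (TensorProduct.map LinearMap.id (C.comul W Q Y).toLinearMap)
          ((C.comul Z W Y).toLinearMap.lTensor _ t)) =
      ((TensorProduct.assoc k _ _ _).symm.toLinearMap ∘ₗ
        ((C.comul Z W Q).toLinearMap.rTensor _ ∘ₗ (C.comul Z Q Y).toLinearMap).lTensor _).lTensor _
        (TensorProduct.assoc k _ _ _ ((C.comul X P Z).toLinearMap.rTensor _ t)) := by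
    intro t
    induction t with
    | zero => simp only [LinearMap.map_zero, LinearEquiv.map_zero, LinearMap.zero_apply, TensorProduct.zero_tmul, TensorProduct.tmul_zero, mul_zero, zero_mul]
    | add x y hx hy => simp only [LinearMap.map_add, LinearEquiv.map_add, hx, hy]
    | tmul u v =>
      have h := C.coassoc Z W Q Y v
      have h' : (C.comul Z W Q).toLinearMap.rTensor _ (C.comul Z Q Y v) =
        (TensorProduct.assoc k _ _ _).symm
          ((C.comul W Q Y).toLinearMap.lTensor _ (C.comul Z W Y v)) := by
        rw [← h, LinearEquiv.symm_apply_apply]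
      simp only [LinearMap.lTensor_tmul, LinearMap.rTensor_tmul, AlgHom.toLinearMap_apply,
        TensorProduct.map_tmul]
      generalize C.comul X P Z u = s
      induction s with
      | zero => simp only [LinearMap.map_zero, LinearEquiv.map_zero, LinearMap.zero_apply, TensorProduct.zero_tmul, TensorProduct.tmul_zero, mul_zero, zero_mul]
      | add x y hx hy => simp only [LinearMap.map_add, LinearEquiv.map_add, TensorProduct.add_tmul, hx, hy]
      | tmul p q =>
        simp only [regroup, LinearMap.comp_apply, LinearEquiv.coe_coe, TensorProduct.assoc_tmul,
          LinearMap.lTensor_tmul, AlgHom.toLinearMap_apply, h']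
        rfl
  rw [C.comul₃_apply, key2, C.coassoc, C.comul₃_apply]
  generalize C.comul X P Y a = t
  induction t with
  | zero => simp only [LinearMap.map_zero, LinearEquiv.map_zero, LinearMap.zero_apply, TensorProduct.zero_tmul, TensorProduct.tmul_zero, mul_zero, zero_mul]
  | add x y hx hy => simp only [LinearMap.map_add, LinearEquiv.map_add, hx, hy]
  | tmul u v =>
    simp only [LinearMap.lTensor_tmul, AlgHom.toLinearMap_apply, LinearMap.comp_apply,
      LinearEquiv.coe_coe, key, TensorProduct.map_tmul, LinearMap.id_apply]
    rfl

/-- `Δ(S(a)) = S(a₂) ⊗ S(a₁)`. -/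
theorem comul_S (X Z Y : Ob) (a : C.alg Y X) :
    C.comul X Z Y (C.S Y X a) = TensorProduct.comm k _ _
      (TensorProduct.map (C.S Y Z) (C.S Z X) (C.comul Y Z X a)) := by
  refine LinearMap.congr_fun (conv_unique (C.comul Y Y X).toLinearMap (C.comul Y X X).toLinearMap
    (C.comul Y X Y).toLinearMap (C.comul X Y X).toLinearMap (C.counit Y).toLinearMap
    (C.counit X).toLinearMap (C.coassoc Y X Y X) (C.counit_comul Y X) (C.comul_counit Y X)
    ((C.comul X Z Y).toLinearMap ∘ₗ C.S Y X)
    ((TensorProduct.comm k _ _).toLinearMap ∘ₗ TensorProduct.map (C.S Y Z) (C.S Z X) ∘ₗ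
      (C.comul Y Z X).toLinearMap) (C.comul X Z Y).toLinearMap ?_ ?_) a
  · intro x
    have h := congrArg (C.comul X Z Y) (C.S_mul Y X x)
    rw [AlgHom.commutes] at h
    refine Eq.trans ?_ h
    simp only [AlgHom.toLinearMap_apply]
    generalize C.comul Y X Y x = t
    induction t with
    | zero => simp only [map_add, map_zero, LinearMap.map_zero, LinearEquiv.map_zero, LinearMap.zero_apply, TensorProduct.zero_tmul, TensorProduct.tmul_zero, mul_zero, zero_mul]
    | add x y hx hy => simp only [map_add, map_zero, LinearMap.map_add, LinearEquiv.map_add, hx, hy]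
    | tmul u v => simp
  · intro x
    -- `(p ⊗ q) ⊗ r ⊗ s ↦ p S(s) ⊗ q S(r)`, applied to the fourfold comultiplication
    let K : C.alg X Z ⊗[k] (C.alg Z Y ⊗[k] C.alg Y Z ⊗[k] C.alg Z X) →ₗ[k]
        C.alg X Z ⊗[k] C.alg Z Y :=
      TensorProduct.map (LinearMap.mul' k _ ∘ₗ (C.S Z X).lTensor _)
          (LinearMap.mul' k _ ∘ₗ (C.S Y Z).lTensor _) ∘ₗ
        (TensorProduct.assoc k _ _ _).symm.toLinearMap ∘ₗ
        (TensorProduct.comm k _ _).toLinearMap.lTensor _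
    have hK : ∀ p q s, K (p ⊗ₜ (q ⊗ₜ s)) =
        (p * C.S Z X s) ⊗ₜ (LinearMap.mul' k _ ((C.S Y Z).lTensor _ q)) := by
      intro p q s
      simp [K]
    clear_value K
    have key : ∀ t : C.alg X Y ⊗[k] C.alg Y X,
        LinearMap.mul' k _ (TensorProduct.map (C.comul X Z Y).toLinearMap
          ((TensorProduct.comm k _ _).toLinearMap ∘ₗ TensorProduct.map (C.S Y Z) (C.S Z X) ∘ₗ
            (C.comul Y Z X).toLinearMap) t) =
        K ((((TensorProduct.assoc k _ _ _).symm.toLinearMap) ∘ₗ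
            (C.comul Y Z X).toLinearMap.lTensor _).lTensor _
            (TensorProduct.assoc k _ _ _ ((C.comul X Z Y).toLinearMap.rTensor _ t))) := by
      intro t
      induction t with
      | zero => simp only [LinearMap.map_zero, LinearEquiv.map_zero, LinearMap.zero_apply, TensorProduct.zero_tmul, TensorProduct.tmul_zero, mul_zero, zero_mul]
      | add x y hx hy => simp only [LinearMap.map_add, LinearEquiv.map_add, hx, hy]
      | tmul u v =>
        simp only [TensorProduct.map_tmul, LinearMap.rTensor_tmul, AlgHom.toLinearMap_apply]
        generalize C.comul X Z Y u = s
        induction s with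
        | zero => simp only [LinearMap.map_zero, LinearEquiv.map_zero, LinearMap.zero_apply, TensorProduct.zero_tmul, TensorProduct.tmul_zero, mul_zero, zero_mul]
        | add x y hx hy => simp only [LinearMap.map_add, LinearEquiv.map_add, TensorProduct.add_tmul, hx, hy]
        | tmul p q =>
          simp only [TensorProduct.assoc_tmul, LinearMap.lTensor_tmul, LinearMap.comp_apply,
            AlgHom.toLinearMap_apply]
          generalize C.comul Y Z X v = s
          induction s with
          | zero => simp only [LinearMap.map_zero, LinearEquiv.map_zero, LinearMap.zero_apply, TensorProduct.zero_tmul, TensorProduct.tmul_zero, mul_zero, zero_mul]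
          | add x y hx hy => simp only [LinearMap.map_add, LinearEquiv.map_add, TensorProduct.tmul_add, hx, hy]
          | tmul r s => simp [hK]
    refine (key _).trans ?_
    rw [AlgHom.toLinearMap_apply, C.coassoc]
    have h2 := C.mul_S X Z x
    refine Eq.trans ?_ ((congrArg (fun y => y ⊗ₜ[k] (1 : C.alg Z Y)) h2).trans ?_)
    · generalize C.comul X Z X x = t
      induction t with
      | zero => simp only [LinearMap.map_zero, LinearEquiv.map_zero, LinearMap.zero_apply, TensorProduct.zero_tmul, TensorProduct.tmul_zero, mul_zero, zero_mul]
      | add x y hx hy => simp only [LinearMap.map_add, LinearEquiv.map_add, TensorProduct.add_tmul, hx, hy]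
      | tmul u v =>
        simp only [LinearMap.lTensor_tmul, AlgHom.toLinearMap_apply, LinearMap.comp_apply]
        rw [← C.coassoc Z Y Z X v]
        simp only [LinearEquiv.coe_coe, LinearEquiv.symm_apply_apply, LinearMap.mul'_apply]
        have h3 := C.counit_comul Z X v
        conv_rhs => rw [← h3]
        generalize C.comul Z Z X v = s
        induction s with
        | zero => simp only [LinearMap.map_zero, LinearEquiv.map_zero, LinearMap.zero_apply, TensorProduct.zero_tmul, TensorProduct.tmul_zero, mul_zero, zero_mul]
        | add x y hx hy => simp only [LinearMap.map_add, LinearEquiv.map_add, TensorProduct.add_tmul, TensorProduct.tmul_add,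
            mul_add, hx, hy]
        | tmul r s =>
          simp [hK, C.mul_S, Algebra.algebraMap_eq_smul_one, TensorProduct.smul_tmul']
    · simp [Algebra.algebraMap_eq_smul_one, Algebra.TensorProduct.one_def,
        TensorProduct.smul_tmul']

theorem S_antimul (X Y : Ob) (a b : C.alg Y X) : C.S Y X (a * b) = C.S Y X b * C.S Y X a := by
  let ee := fun (X : Ob) => LinearMap.mul' k k ∘ₗ
    TensorProduct.map (C.counit X).toLinearMap (C.counit X).toLinearMap
  refine LinearMap.congr_fun (conv_unique (sq (C.comul Y Y X).toLinearMap)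
    (sq (C.comul Y X X).toLinearMap) (sq (C.comul Y X Y).toLinearMap)
    (sq (C.comul X Y X).toLinearMap) (ee Y) (ee X) ?_ ?_ ?_ (C.S Y X ∘ₗ LinearMap.mul' k _)
    (LinearMap.mul' k _ ∘ₗ (TensorProduct.comm k _ _).toLinearMap ∘ₗ
      TensorProduct.map (C.S Y X) (C.S Y X)) (LinearMap.mul' k _) ?_ ?_) (a ⊗ₜ b)
  · exact sq_coassoc _ _ _ _ (C.coassoc Y X Y X)
  · intro p
    induction p with
    | zero => simp only [LinearMap.map_zero, LinearEquiv.map_zero, LinearMap.zero_apply, TensorProduct.zero_tmul, TensorProduct.tmul_zero, mul_zero, zero_mul]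
    | add x y hx hy => simp only [LinearMap.map_add, LinearEquiv.map_add, hx, hy]
    | tmul a b =>
      have h : ∀ s t : C.alg Y Y ⊗[k] C.alg Y X,
          TensorProduct.lid k _ ((ee Y).rTensor _ (TensorProduct.tensorTensorTensorComm k _ _ _ _ (s ⊗ₜ t))) =
          TensorProduct.lid k _ ((C.counit Y).toLinearMap.rTensor _ s) ⊗ₜ
            TensorProduct.lid k _ ((C.counit Y).toLinearMap.rTensor _ t) := by
        intro s t
        induction s with
        | zero => simp only [LinearMap.map_zero, LinearEquiv.map_zero, LinearMap.zero_apply, TensorProduct.zero_tmul, TensorProduct.tmul_zero, mul_zero, zero_mul]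
        | add x y hx hy => simp only [LinearMap.map_add, LinearEquiv.map_add, TensorProduct.add_tmul, hx, hy]
        | tmul s s' =>
        induction t with
        | zero => simp only [LinearMap.map_zero, LinearEquiv.map_zero, LinearMap.zero_apply, TensorProduct.zero_tmul, TensorProduct.tmul_zero, mul_zero, zero_mul]
        | add x y hx hy => simp only [LinearMap.map_add, LinearEquiv.map_add, TensorProduct.tmul_add, hx, hy]
        | tmul t t' =>
          simp [ee, TensorProduct.smul_tmul', mul_smul, TensorProduct.tmul_smul]
          rw [smul_comm]
      have e1 := h (C.comul Y Y X a) (C.comul Y Y X b)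
      rw [C.counit_comul, C.counit_comul] at e1
      rw [sq_tmul]
      exact e1
  · intro p
    induction p with
    | zero => simp only [LinearMap.map_zero, LinearEquiv.map_zero, LinearMap.zero_apply, TensorProduct.zero_tmul, TensorProduct.tmul_zero, mul_zero, zero_mul]
    | add x y hx hy => simp only [LinearMap.map_add, LinearEquiv.map_add, hx, hy]
    | tmul a b =>
      have h : ∀ s t : C.alg Y X ⊗[k] C.alg X X,
          TensorProduct.rid k _ ((ee X).lTensor _ (TensorProduct.tensorTensorTensorComm k _ _ _ _ (s ⊗ₜ t))) =
          TensorProduct.rid k _ ((C.counit X).toLinearMap.lTensor _ s) ⊗ₜ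
            TensorProduct.rid k _ ((C.counit X).toLinearMap.lTensor _ t) := by
        intro s t
        induction s with
        | zero => simp only [LinearMap.map_zero, LinearEquiv.map_zero, LinearMap.zero_apply, TensorProduct.zero_tmul, TensorProduct.tmul_zero, mul_zero, zero_mul]
        | add x y hx hy => simp only [LinearMap.map_add, LinearEquiv.map_add, TensorProduct.add_tmul, hx, hy]
        | tmul s s' =>
        induction t with
        | zero => simp only [LinearMap.map_zero, LinearEquiv.map_zero, LinearMap.zero_apply, TensorProduct.zero_tmul, TensorProduct.tmul_zero, mul_zero, zero_mul]
        | add x y hx hy => simp only [LinearMap.map_add, LinearEquiv.map_add, TensorProduct.tmul_add, hx, hy]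
        | tmul t t' =>
          simp [ee, TensorProduct.smul_tmul', mul_smul, TensorProduct.tmul_smul]
          rw [smul_comm]
      have e1 := h (C.comul Y X X a) (C.comul Y X X b)
      rw [C.comul_counit, C.comul_counit] at e1
      rw [sq_tmul]
      exact e1
  · intro x
    induction x with
    | zero => simp only [map_add, map_zero, LinearMap.map_zero, LinearEquiv.map_zero, LinearMap.zero_apply, TensorProduct.zero_tmul, TensorProduct.tmul_zero, mul_zero, zero_mul]
    | add x y hx hy => simp only [map_add, map_zero, LinearMap.map_add, LinearEquiv.map_add, hx, hy]
    | tmul a b =>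
      have h : ∀ s t : C.alg Y X ⊗[k] C.alg X Y,
          LinearMap.mul' k _ (TensorProduct.map (C.S Y X ∘ₗ LinearMap.mul' k _) (LinearMap.mul' k _)
            (TensorProduct.tensorTensorTensorComm k _ _ _ _ (s ⊗ₜ t))) =
          LinearMap.mul' k _ ((C.S Y X).rTensor _ (s * t)) := by
        intro s t
        induction s with
        | zero => simp only [LinearMap.map_zero, LinearEquiv.map_zero, LinearMap.zero_apply, TensorProduct.zero_tmul, TensorProduct.tmul_zero, mul_zero, zero_mul]
        | add x y hx hy => simp only [LinearMap.map_add, LinearEquiv.map_add, TensorProduct.add_tmul, add_mul, hx, hy]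
        | tmul s s' =>
        induction t with
        | zero => simp only [LinearMap.map_zero, LinearEquiv.map_zero, LinearMap.zero_apply, TensorProduct.zero_tmul, TensorProduct.tmul_zero, mul_zero, zero_mul]
        | add x y hx hy => simp only [LinearMap.map_add, LinearEquiv.map_add, TensorProduct.tmul_add, mul_add, hx, hy]
        | tmul t t' => simp
      have e1 := h (C.comul Y X Y a) (C.comul Y X Y b)
      rw [← map_mul, C.S_mul] at e1
      rw [sq_tmul]
      refine e1.trans ?_
      simp [ee]
  · intro x
    induction x with
    | zero => simp only [map_add, map_zero, LinearMap.map_zero, LinearEquiv.map_zero, LinearMap.zero_apply, TensorProduct.zero_tmul, TensorProduct.tmul_zero, mul_zero, zero_mul]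
    | add x y hx hy => simp only [map_add, map_zero, LinearMap.map_add, LinearEquiv.map_add, hx, hy]
    | tmul a b =>
      have h : ∀ s t : C.alg X Y ⊗[k] C.alg Y X,
          LinearMap.mul' k _ (TensorProduct.map (LinearMap.mul' k _)
            (LinearMap.mul' k _ ∘ₗ (TensorProduct.comm k _ _).toLinearMap ∘ₗ
              TensorProduct.map (C.S Y X) (C.S Y X))
            (TensorProduct.tensorTensorTensorComm k _ _ _ _ (s ⊗ₜ t))) =
          LinearMap.mul' k _ ((LinearMap.mulRight k
            (LinearMap.mul' k _ ((C.S Y X).lTensor _ t))).rTensor _ ((C.S Y X).lTensor _ s)) := by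
        intro s t
        induction s with
        | zero => simp only [TensorProduct.zero_tmul, map_zero]
        | add x y hx hy => simp only [LinearMap.map_add, LinearEquiv.map_add, TensorProduct.add_tmul, hx, hy]
        | tmul s s' =>
          induction t with
          | zero => simp
          | add x y hx hy =>
            simp only [LinearMap.map_add, LinearEquiv.map_add, TensorProduct.tmul_add, hx, hy, LinearMap.lTensor_tmul,
              LinearMap.rTensor_tmul, LinearMap.mul'_apply, LinearMap.mulRight_apply, mul_add,
              add_mul]
          | tmul t t' => simp [mul_assoc]
      have e1 := h (C.comul X Y X a) (C.comul X Y X b)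
      rw [sq_tmul]
      refine e1.trans ?_
      rw [C.mul_S]
      have h' : ∀ s : C.alg X Y ⊗[k] C.alg X Y,
          LinearMap.mul' k _ ((LinearMap.mulRight k
            (algebraMap k (C.alg X Y) (C.counit X b))).rTensor _ s) =
          LinearMap.mul' k _ s * algebraMap k _ (C.counit X b) := by
        intro s
        induction s with
        | zero => simp only [LinearMap.map_zero, LinearEquiv.map_zero, LinearMap.zero_apply, TensorProduct.zero_tmul, TensorProduct.tmul_zero, mul_zero, zero_mul]
        | add x y hx hy => simp only [LinearMap.map_add, LinearEquiv.map_add, add_mul, hx, hy]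
        | tmul s s' => simp [mul_assoc, Algebra.commutes]
      rw [h', C.mul_S]
      simp [ee]

end

end Cogroupoid

section Modules

variable (k H : Type u) [Field k] [Ring H] [HopfAlgebra k H]

/-- A right comodule over `H`: a vector space `V` with a coaction `V → V ⊗ H`. -/
structure RightComodule where
  /-- The underlying vector space. -/
  carrier : Type u
  [addCommGroup : AddCommGroup carrier]
  [module : Module k carrier]
  /-- The coaction `v ↦ v₍₀₎ ⊗ v₍₁₎`. -/
  coact : carrier →ₗ[k] carrier ⊗[k] H
  coact_coassoc : ∀ v, TensorProduct.assoc k carrier H H (coact.rTensor H (coact v)) =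
    (Coalgebra.comul (R := k) (A := H)).lTensor carrier (coact v)
  coact_counit : ∀ v, TensorProduct.rid k carrier
    ((Coalgebra.counit (R := k) (A := H)).lTensor carrier (coact v)) = v

attribute [instance] RightComodule.addCommGroup RightComodule.module

/-- The map `h ↦ h₁ ⊗ h₂ ⊗ h₃`. -/
noncomputable def comul₃ : H →ₗ[k] H ⊗[k] (H ⊗[k] H) :=
  (Coalgebra.comul (R := k) (A := H)).lTensor H ∘ₗ Coalgebra.comul

/-- A right-right Yetter-Drinfeld module over `H`: a right `H`-comodule `V` with a right `H`-module
structure `(v, h) ↦ v · h` such that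
`(v · h)₍₀₎ ⊗ (v · h)₍₁₎ = v₍₀₎ · h₂ ⊗ S(h₁) v₍₁₎ h₃`. -/
structure YDModule extends RightComodule k H where
  /-- The right action `(v, h) ↦ v · h`. -/
  act : carrier →ₗ[k] H →ₗ[k] carrier
  act_one : ∀ v, act v 1 = v
  act_mul : ∀ v h h', act v (h * h') = act (act v h) h'
  coact_act : ∀ v h, coact (act v h) =
    sandwich act (HopfAlgebra.antipode k (A := H)) (coact v) (comul₃ k H h)

variable {k H}

namespace YDModule

/-- Morphisms of Yetter-Drinfeld modules: linear maps that are `H`-linear and `H`-colinear. -/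
@[ext]
structure Hom (M N : YDModule k H) where
  /-- The underlying linear map. -/
  lin : M.carrier →ₗ[k] N.carrier
  map_act : ∀ v h, lin (M.act v h) = N.act (lin v) h
  map_coact : ∀ v, N.coact (lin v) = lin.rTensor H (M.coact v)

noncomputable instance : Category (YDModule k H) where
  Hom := Hom
  id M := ⟨LinearMap.id, fun _ _ => rfl, fun v => by simp⟩
  comp f g := ⟨g.lin ∘ₗ f.lin, fun v h => by simp [f.map_act, g.map_act], fun v => by
    simp [f.map_coact, g.map_coact, LinearMap.rTensor_comp]⟩

@[ext]
theorem hom_ext {M N : YDModule k H} {f g : M ⟶ N} (h : f.lin = g.lin) : f = g :=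
  Hom.ext h

@[simp]
theorem id_lin (M : YDModule k H) : (𝟙 M : M ⟶ M).lin = LinearMap.id := rfl

@[simp]
theorem comp_lin {M N P : YDModule k H} (f : M ⟶ N) (g : N ⟶ P) :
    (f ≫ g).lin = g.lin ∘ₗ f.lin := rfl

noncomputable instance : Limits.HasZeroMorphisms (YDModule k H) where
  zero M N := ⟨⟨0, fun v h => by simp, fun v => by simp⟩⟩
  comp_zero f P := by
    apply hom_ext
    exact LinearMap.zero_comp _
  zero_comp M N P f := by
    apply hom_ext
    exact LinearMap.comp_zero _

@[simp]
theorem zero_lin (M N : YDModule k H) : (0 : M ⟶ N).lin = 0 := rfl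

theorem subtype_rTensor_injective {E : Type*} [AddCommGroup E] [Module k E] {V : Type*}
    [AddCommGroup V] [Module k V] (W : Submodule k V) :
    Function.Injective (W.subtype.rTensor E) :=
  Module.Flat.rTensor_preserves_injective_linearMap _ W.injective_subtype

/-- The restriction of the coaction to a subspace `W` that it maps to `W ⊗ H`. -/
noncomputable def subCoact (M : YDModule k H) (W : Submodule k M.carrier)
    (hco : ∀ w ∈ W, M.coact w ∈ LinearMap.range (W.subtype.rTensor H)) : W →ₗ[k] W ⊗[k] H :=
  (LinearEquiv.ofInjective _ (subtype_rTensor_injective W)).symm.toLinearMap ∘ₗ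
    (M.coact ∘ₗ W.subtype).codRestrict _ (fun w => hco w w.2)

theorem rTensor_subCoact (M : YDModule k H) (W : Submodule k M.carrier)
    (hco : ∀ w ∈ W, M.coact w ∈ LinearMap.range (W.subtype.rTensor H)) (w : W) :
    W.subtype.rTensor H (M.subCoact W hco w) = M.coact w := by
  have := LinearEquiv.apply_symm_apply (LinearEquiv.ofInjective (W.subtype.rTensor H)
    (subtype_rTensor_injective W)) ((M.coact ∘ₗ W.subtype).codRestrict _ (fun w => hco w w.2) w)
  exact congrArg Subtype.val this

/-- A subspace `W` of a Yetter-Drinfeld module that is stable under the action and such that the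
coaction maps `W` to (the image of) `W ⊗ H`, as a Yetter-Drinfeld module with the restricted action
and coaction. -/
noncomputable def sub (M : YDModule k H) (W : Submodule k M.carrier)
    (hact : ∀ w ∈ W, ∀ h, M.act w h ∈ W)
    (hco : ∀ w ∈ W, M.coact w ∈ LinearMap.range (W.subtype.rTensor H)) : YDModule k H where
  carrier := W
  coact := M.subCoact W hco
  act := LinearMap.mk₂ k (fun w h => ⟨M.act w h, hact w w.2 h⟩)
    (by intros; ext; simp) (by intros; ext; simp) (by intros; ext; simp) (by intros; ext; simp)
  coact_coassoc w := by
    apply subtype_rTensor_injective W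
    have h1 : ∀ t : W ⊗[k] H, W.subtype.rTensor (H ⊗[k] H) (TensorProduct.assoc k _ _ _
        ((M.subCoact W hco).rTensor H t)) =
        TensorProduct.assoc k _ _ _ (M.coact.rTensor H (W.subtype.rTensor H t)) := by
      intro t
      induction t with
      | zero => simp
      | add x y hx hy => simp only [map_add, hx, hy]
      | tmul w h =>
        simp only [LinearMap.rTensor_tmul, Submodule.subtype_apply, ← M.rTensor_subCoact W hco w]
        generalize M.subCoact W hco w = s
        induction s with
        | zero => simp
        | add x y hx hy => simp only [map_add, TensorProduct.add_tmul, hx, hy]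
        | tmul w h => simp
    have h2 : ∀ t : W ⊗[k] H, W.subtype.rTensor (H ⊗[k] H)
        ((Coalgebra.comul (R := k) (A := H)).lTensor W t) =
        (Coalgebra.comul (R := k) (A := H)).lTensor M.carrier (W.subtype.rTensor H t) := by
      intro t
      induction t with
      | zero => simp
      | add x y hx hy => simp only [map_add, hx, hy]
      | tmul w h => simp
    rw [h1, h2, rTensor_subCoact]
    exact M.coact_coassoc w
  coact_counit w := by
    apply W.injective_subtype
    have h : ∀ t : W ⊗[k] H, W.subtype (TensorProduct.rid k W
        ((Coalgebra.counit (R := k) (A := H)).lTensor W t)) =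
        TensorProduct.rid k M.carrier ((Coalgebra.counit (R := k) (A := H)).lTensor M.carrier
          (W.subtype.rTensor H t)) := by
      intro t
      induction t with
      | zero => simp
      | add x y hx hy => simp only [map_add, hx, hy]
      | tmul w h => simp
    rw [h, rTensor_subCoact]
    exact M.coact_counit w
  act_one w := by ext; simp [M.act_one]
  act_mul w h h' := by ext; simp [M.act_mul]
  coact_act w h := by
    apply subtype_rTensor_injective W
    rw [rTensor_subCoact, sandwich_map _ _ M.act W.subtype W.subtype LinearMap.id
      (by intros; simp), rTensor_subCoact]
    simpa using M.coact_act w h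

end YDModule

/-- `k` with `x · h = ε(h) x` and coaction `x ↦ x ⊗ 1`. -/
noncomputable def YDModule.trivial (k H : Type u) [Field k] [Ring H] [HopfAlgebra k H] :
    YDModule k H where
  carrier := k
  coact := (TensorProduct.mk k k H).flip 1
  coact_coassoc v := by simp [Algebra.TensorProduct.one_def]
  coact_counit v := by simp
  act := (LinearMap.mul k k).compl₂ Coalgebra.counit
  act_one v := by simp
  act_mul v h h' := by simp [mul_assoc]
  coact_act v h := by
    have key : ∀ t : H ⊗[k] (H ⊗[k] H), sandwich ((LinearMap.mul k k).compl₂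
        (Coalgebra.counit (R := k) (A := H))) (HopfAlgebra.antipode k (A := H)) (v ⊗ₜ 1) t =
        v ⊗ₜ LinearMap.mul' k H ((HopfAlgebra.antipode k (A := H)).rTensor H
          (((TensorProduct.lid k H).toLinearMap ∘ₗ
            (Coalgebra.counit (R := k) (A := H)).rTensor H).lTensor H t)) := by
      intro t
      induction t with
      | zero => simp
      | add x y hx hy => simp only [map_add, TensorProduct.tmul_add, hx, hy]
      | tmul a t =>
        induction t with
        | zero => simp
        | add x y hx hy => simp only [map_add, TensorProduct.tmul_add, hx, hy]
        | tmul b c => simp [TensorProduct.smul_tmul', mul_comm]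
    have h2 : (TensorProduct.lid k H).toLinearMap ∘ₗ
        (Coalgebra.counit (R := k) (A := H)).rTensor H ∘ₗ Coalgebra.comul = LinearMap.id := by
      ext h
      simp
    have h3 : ((TensorProduct.lid k H).toLinearMap ∘ₗ
        (Coalgebra.counit (R := k) (A := H)).rTensor H).lTensor H (comul₃ k H h) =
        Coalgebra.comul h := by
      rw [comul₃, LinearMap.comp_apply, ← LinearMap.comp_apply (LinearMap.lTensor H _),
        ← LinearMap.lTensor_comp, LinearMap.comp_assoc, h2]
      simp
    refine Eq.trans ?_ (key _).symm
    rw [h3, HopfAlgebra.mul_antipode_rTensor_comul_apply]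
    simp [Algebra.algebraMap_eq_smul_one, TensorProduct.smul_tmul', mul_comm]

/-- The map `v ⊗ h ↦ v₍₀₎ ⊗ h₂ ⊗ S(h₁) v₍₁₎ h₃`. -/
noncomputable def freeCoact (V : RightComodule k H) :
    V.carrier ⊗[k] H →ₗ[k] (V.carrier ⊗[k] H) ⊗[k] H :=
  TensorProduct.lift
    ((sandwich (TensorProduct.mk k V.carrier H) (HopfAlgebra.antipode k (A := H))).compl₂
      (comul₃ k H) ∘ₗ V.coact)

theorem freeCoact_tmul (V : RightComodule k H) (v : V.carrier) (h : H) :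
    freeCoact V (v ⊗ₜ h) = sandwich (TensorProduct.mk k V.carrier H)
      (HopfAlgebra.antipode k (A := H)) (V.coact v) (comul₃ k H h) := by
  simp [freeCoact]

theorem free_coact_push (V : RightComodule k H) (x : V.carrier ⊗[k] H) (t : H ⊗[k] (H ⊗[k] H)) :
    (TensorProduct.assoc k _ H H).symm ((Coalgebra.comul (R := k) (A := H)).lTensor _
      (sandwich (TensorProduct.mk k V.carrier H) (HopfAlgebra.antipode k (A := H)) x t)) =
    sandwich (sandwich (TensorProduct.mk k V.carrier H) (HopfAlgebra.antipode k (A := H)))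
      (HopfAlgebra.antipode k (A := H))
      ((TensorProduct.assoc k _ _ _).symm ((Coalgebra.comul (R := k) (A := H)).lTensor _ x))
      (regroup k H H H H H (TensorProduct.map Coalgebra.comul
        (TensorProduct.map LinearMap.id Coalgebra.comul) t)) :=
  sandwich_comul (TensorProduct.mk k V.carrier H) (HopfAlgebra.antipode k (A := H))
    (Bialgebra.comulAlgHom k H) Coalgebra.comul _ _
    ((Cogroupoid.ofHopf k H).comul_S ⟨⟩ ⟨⟩ ⟨⟩) x t

theorem comul₃_five (h : H) :
    regroup k H H H H H (TensorProduct.map Coalgebra.comul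
        (TensorProduct.map LinearMap.id Coalgebra.comul) (comul₃ k H h)) =
      TensorProduct.map LinearMap.id (TensorProduct.map (comul₃ k H) LinearMap.id)
        (comul₃ k H h) :=
  (Cogroupoid.ofHopf k H).five ⟨⟩ ⟨⟩ ⟨⟩ ⟨⟩ ⟨⟩ ⟨⟩ h

/-- The free Yetter-Drinfeld module `V ⊠ H` on a right comodule `V`: the vector space `V ⊗ H` with
`(v ⊗ h) · g = v ⊗ hg` and the coaction `v ⊗ h ↦ v₍₀₎ ⊗ h₂ ⊗ S(h₁) v₍₁₎ h₃`. -/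
noncomputable def YDModule.free (V : RightComodule k H) : YDModule k H where
  carrier := V.carrier ⊗[k] H
  coact := freeCoact V
  act := LinearMap.lTensorHom V.carrier ∘ₗ (LinearMap.mul k H).flip |>.flip
  coact_coassoc v := by
    induction v with
    | zero => simp
    | add x y hx hy => simp only [map_add, hx, hy]
    | tmul v h =>
      have e := free_coact_push V (V.coact v) (comul₃ k H h)
      rw [LinearEquiv.symm_apply_eq] at e
      have e' := sandwich_map (TensorProduct.mk k V.carrier H)
        (HopfAlgebra.antipode k (A := H))
        (sandwich (TensorProduct.mk k V.carrier H) (HopfAlgebra.antipode k (A := H)))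
        V.coact (freeCoact V) (comul₃ k H) (by intros; simp [freeCoact_tmul]) (V.coact v) (comul₃ k H h)
      rw [freeCoact_tmul, e', e, comul₃_five,
        ← V.coact_coassoc, LinearEquiv.symm_apply_apply]
  coact_counit v := by
    induction v with
    | zero => simp
    | add x y hx hy => simp only [map_add, hx, hy]
    | tmul v h => 
      rw [freeCoact_tmul]
      have key : ∀ (x : V.carrier ⊗[k] H) (t : H ⊗[k] (H ⊗[k] H)),
          TensorProduct.rid k _ ((Coalgebra.counit (R := k) (A := H)).lTensor _
            (sandwich (TensorProduct.mk k V.carrier H) (HopfAlgebra.antipode k (A := H)) x t)) =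
          TensorProduct.rid k _ ((Coalgebra.counit (R := k) (A := H)).lTensor _ x) ⊗ₜ
            TensorProduct.lid k H ((Coalgebra.counit (R := k) (A := H)).rTensor H
              (((TensorProduct.rid k H).toLinearMap ∘ₗ
                (Coalgebra.counit (R := k) (A := H)).lTensor H).lTensor H t)) := by
        intro x t
        induction x with
        | zero => simp
        | add x y hx hy =>
          simp only [map_add, TensorProduct.add_tmul, LinearMap.add_apply, hx, hy]
        | tmul v d =>
        induction t with
        | zero => simp
        | add x y hx hy => simp only [map_add, TensorProduct.tmul_add, hx, hy]
        | tmul a t =>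
        induction t with
        | zero => simp
        | add x y hx hy => simp only [map_add, TensorProduct.tmul_add, hx, hy]
        | tmul b c =>
          simp only [sandwich_tmul, TensorProduct.mk_apply, LinearMap.lTensor_tmul,
            TensorProduct.rid_tmul, LinearMap.rTensor_tmul, TensorProduct.lid_tmul,
            LinearMap.comp_apply, LinearEquiv.coe_coe, Bialgebra.counit_mul,
            HopfAlgebra.counit_antipode, TensorProduct.smul_tmul', TensorProduct.tmul_smul,
            smul_smul, map_smul, smul_eq_mul]
          congr 2
          ring
      have h2 : (TensorProduct.rid k H).toLinearMap ∘ₗ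
          (Coalgebra.counit (R := k) (A := H)).lTensor H ∘ₗ Coalgebra.comul = LinearMap.id := by
        ext h
        simp
      have h3 : ((TensorProduct.rid k H).toLinearMap ∘ₗ
          (Coalgebra.counit (R := k) (A := H)).lTensor H).lTensor H (comul₃ k H h) =
          Coalgebra.comul h := by
        rw [comul₃, LinearMap.comp_apply, ← LinearMap.comp_apply (LinearMap.lTensor H _),
          ← LinearMap.lTensor_comp, LinearMap.comp_assoc, h2]
        simp
      rw [key, V.coact_counit, h3]
      simp
  act_one v := by
    induction v with
    | zero => simp
    | add x y hx hy => simp only [map_add, LinearMap.add_apply, hx, hy]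
    | tmul v h => simp
  act_mul v h h' := by
    induction v with
    | zero => simp
    | add x y hx hy => simp only [map_add, LinearMap.add_apply, hx, hy]
    | tmul v h => simp [mul_assoc]
  coact_act v g := by
    induction v with
    | zero => simp
    | add x y hx hy => simp only [map_add, LinearMap.add_apply, hx, hy]
    | tmul v h =>
      rw [freeCoact_tmul]
      rw [sandwich_mul (TensorProduct.mk k V.carrier H) _ (TensorProduct.mk k V.carrier H)
        _ (by intros; simp) HopfAlgebra.antipode_mul_antidistrib]
      have : comul₃ k H h * comul₃ k H g = comul₃ k H (h * g) :=
        (map_mul ((Cogroupoid.ofHopf k H).comul₃ ⟨⟩ ⟨⟩ ⟨⟩ ⟨⟩) h g).symm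
      rw [this, ← freeCoact_tmul]
      simp

end Modules

namespace Cogroupoid

section

variable {k : Type u} [Field k] {Ob : Type*} (C : Cogroupoid k Ob) (X Y : Ob)

/-- The Yetter-Drinfeld module `V ⊗ C(X,Y)` over `C(Y,Y)`, with the action
`(v ⊗ a) · b = v · b₂ ⊗ S(b₁) a b₃`, where `b₁ ⊗ b₂ ⊗ b₃ ∈ C(Y,X) ⊗ C(X,X) ⊗ C(X,Y)`, and the
coaction `v ⊗ a ↦ v ⊗ a₁ ⊗ a₂`, where `a₁ ⊗ a₂ ∈ C(X,Y) ⊗ C(Y,Y)`. -/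
noncomputable def tensorYD (M : YDModule k (C.alg X X)) : YDModule k (C.alg Y Y) where
  carrier := M.carrier ⊗[k] C.alg X Y
  coact := (TensorProduct.assoc k M.carrier (C.alg X Y) (C.alg Y Y)).symm.toLinearMap ∘ₗ
    (C.comul X Y Y).toLinearMap.lTensor M.carrier
  act := (sandwich M.act (C.S Y X)).compl₂ (C.comul₃ Y X X Y).toLinearMap
  coact_coassoc v := by
    have key : ∀ x : C.alg X Y, ∀ v : M.carrier, TensorProduct.assoc k _ _ _
        (((TensorProduct.assoc k M.carrier (C.alg X Y) (C.alg Y Y)).symm.toLinearMap ∘ₗ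
          (C.comul X Y Y).toLinearMap.lTensor M.carrier).rTensor _
          ((TensorProduct.assoc k _ _ _).symm (v ⊗ₜ C.comul X Y Y x))) =
        (TensorProduct.assoc k _ _ _).symm (v ⊗ₜ (TensorProduct.assoc k _ _ _
          ((C.comul X Y Y).toLinearMap.rTensor _ (C.comul X Y Y x)))) := by
      intro x v
      generalize C.comul X Y Y x = t
      induction t with
      | zero => simp
      | add x y hx hy => simp only [map_add, TensorProduct.tmul_add, hx, hy]
      | tmul a b =>
        simp only [TensorProduct.assoc_symm_tmul, LinearMap.rTensor_tmul, LinearMap.comp_apply,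
          LinearMap.lTensor_tmul, AlgHom.toLinearMap_apply, LinearEquiv.coe_coe]
        generalize C.comul X Y Y a = t
        induction t with
        | zero => simp
        | add x y hx hy => simp only [map_add, TensorProduct.tmul_add, TensorProduct.add_tmul, hx, hy]
        | tmul a b => simp
    induction v with
    | zero => simp
    | add x y hx hy => simp only [map_add, hx, hy]
    | tmul v a =>
      rw [LinearMap.comp_apply, LinearMap.lTensor_tmul]
      refine (key a v).trans ?_
      rw [C.coassoc]
      simp only [LinearEquiv.coe_coe, AlgHom.toLinearMap_apply]
      generalize C.comul X Y Y a = t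
      induction t with
      | zero => simp
      | add x y hx hy => simp only [map_add, TensorProduct.tmul_add, hx, hy]
      | tmul a b =>
        simp only [LinearMap.lTensor_tmul, TensorProduct.assoc_symm_tmul]
        change _ = (v ⊗ₜ a) ⊗ₜ (C.comul Y Y Y b)
        simp only [AlgHom.toLinearMap_apply]
  coact_counit v := by
    induction v with
    | zero => simp
    | add x y hx hy => simp only [map_add, hx, hy]
    | tmul v a =>
      refine Eq.trans ?_ (congrArg (fun z => v ⊗ₜ[k] z) (C.comul_counit X Y a))
      simp only [LinearMap.comp_apply, LinearMap.lTensor_tmul, AlgHom.toLinearMap_apply,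
        LinearEquiv.coe_coe]
      generalize C.comul X Y Y a = t
      induction t with
      | zero => simp
      | add x y hx hy => simp only [map_add, TensorProduct.tmul_add, hx, hy]
      | tmul a b =>
        simp only [TensorProduct.assoc_symm_tmul, LinearMap.lTensor_tmul,
          TensorProduct.rid_tmul, TensorProduct.tmul_smul, AlgHom.toLinearMap_apply]
        rfl
  act_one v := by
    simp only [LinearMap.compl₂_apply, AlgHom.toLinearMap_apply, map_one]
    exact sandwich_one _ _ M.act_one (C.S_one Y X) v
  act_mul v h h' := by
    simp only [LinearMap.compl₂_apply, AlgHom.toLinearMap_apply, map_mul]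
    exact (sandwich_mul M.act M.act M.act (C.S Y X) (fun v b b' => (M.act_mul v b b').symm)
      (C.S_antimul X Y) v _ _).symm
  coact_act v b := by
    have e := sandwich_comul M.act (C.S Y X) (C.comul X Y Y) (C.comul Y Y X).toLinearMap
      (C.S Y Y) (C.S Y X) (C.comul_S X Y Y) v (C.comul₃ Y X X Y b)
    rw [C.five Y Y X X Y Y b] at e
    refine e.trans ?_
    have e2 : ∀ (x : (M.carrier ⊗[k] C.alg X Y) ⊗[k] C.alg Y Y)
        (t : C.alg Y Y ⊗[k] (C.alg Y Y ⊗[k] C.alg Y Y)),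
        sandwich (sandwich M.act (C.S Y X)) (C.S Y Y) x
          (TensorProduct.map LinearMap.id
            (TensorProduct.map (C.comul₃ Y X X Y).toLinearMap LinearMap.id) t) =
        sandwich ((sandwich M.act (C.S Y X)).compl₂ (C.comul₃ Y X X Y).toLinearMap)
          (C.S Y Y) x t := by
      intro x t
      have := sandwich_map ((sandwich M.act (C.S Y X)).compl₂ (C.comul₃ Y X X Y).toLinearMap)
        (C.S Y Y) (sandwich M.act (C.S Y X)) LinearMap.id LinearMap.id
        (C.comul₃ Y X X Y).toLinearMap (by intros; simp) x t
      simpa using this.symm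
    exact e2 _ _

/-- The cotensor product `V □ C(X,Y)`: the equalizer of the two maps
`V ⊗ C(X,Y) → V ⊗ C(X,X) ⊗ C(X,Y)` given by the coactions of `V` and of `C(X,Y)`. -/
noncomputable def cotensorSubmodule (V : RightComodule k (C.alg X X)) :
    Submodule k (V.carrier ⊗[k] C.alg X Y) :=
  LinearMap.eqLocus
    ((TensorProduct.assoc k V.carrier (C.alg X X) (C.alg X Y)).toLinearMap ∘ₗ
      V.coact.rTensor (C.alg X Y))
    ((C.comul X X Y).toLinearMap.lTensor V.carrier)

theorem tensorYD_coact_map {M N : YDModule k (C.alg X X)} (f : M.carrier →ₗ[k] N.carrier)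
    (x : M.carrier ⊗[k] C.alg X Y) :
    (C.tensorYD X Y N).coact (f.rTensor (C.alg X Y) x) =
      (f.rTensor (C.alg X Y)).rTensor (C.alg Y Y) ((C.tensorYD X Y M).coact x) := by
  change (TensorProduct.assoc k _ _ _).symm ((C.comul X Y Y).toLinearMap.lTensor _
      (f.rTensor (C.alg X Y) x)) = (f.rTensor (C.alg X Y)).rTensor (C.alg Y Y)
    ((TensorProduct.assoc k _ _ _).symm ((C.comul X Y Y).toLinearMap.lTensor _ x))
  induction x with
  | zero => simp
  | add x y hx hy => simp only [map_add, hx, hy]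
  | tmul v a =>
    simp only [LinearMap.rTensor_tmul, LinearMap.lTensor_tmul]
    generalize (C.comul X Y Y).toLinearMap a = t
    induction t with
    | zero => simp
    | add x y hx hy => simp only [map_add, TensorProduct.tmul_add, hx, hy]
    | tmul a b => simp

theorem range_eqLocus {E F L : Type*} [AddCommGroup E] [Module k E] [AddCommGroup F] [Module k F]
    [AddCommGroup L] [Module k L] (f g : E →ₗ[k] F) (x : E ⊗[k] L)
    (hx : f.rTensor L x = g.rTensor L x) :
    x ∈ LinearMap.range ((LinearMap.eqLocus f g).subtype.rTensor L) := by
  rw [LinearMap.eqLocus_eq_ker_sub]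
  refine (Module.Flat.rTensor_exact L (LinearMap.exact_subtype_ker_map (f - g)) x).mp ?_
  rw [LinearMap.rTensor_sub, LinearMap.sub_apply, hx, sub_self]

variable {X Y} in
theorem mem_cotensor_iff {V : RightComodule k (C.alg X X)} {x : V.carrier ⊗[k] C.alg X Y} :
    x ∈ C.cotensorSubmodule X Y V ↔
      TensorProduct.assoc k _ _ _ (V.coact.rTensor (C.alg X Y) x) =
        (C.comul X X Y).toLinearMap.lTensor V.carrier x := Iff.rfl

theorem act_mem_cotensor (M : YDModule k (C.alg X X)) (x : M.carrier ⊗[k] C.alg X Y)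
    (hx : x ∈ C.cotensorSubmodule X Y M.toRightComodule) (b : C.alg Y Y) :
    (C.tensorYD X Y M).act x b ∈ C.cotensorSubmodule X Y M.toRightComodule := by
  rw [mem_cotensor_iff] at hx
  refine C.mem_cotensor_iff.mpr ?_
  change TensorProduct.assoc k _ _ _ (M.coact.rTensor (C.alg X Y)
    (sandwich M.act (C.S Y X) x (C.comul₃ Y X X Y b))) =
      (C.comul X X Y).toLinearMap.lTensor M.carrier
        (sandwich M.act (C.S Y X) x (C.comul₃ Y X X Y b))
  have e := sandwich_comul M.act (C.S Y X) (C.comul X X Y) (C.comul Y X X).toLinearMap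
    (C.S Y X) (C.S X X) (C.comul_S X X Y) x (C.comul₃ Y X X Y b)
  rw [C.five Y X X X X Y b, ← hx, LinearEquiv.symm_apply_apply, LinearEquiv.symm_apply_eq] at e
  rw [e, sandwich_map M.act (C.S Y X) (sandwich M.act (C.S X X)) M.coact M.coact
    (C.comul₃ X X X X).toLinearMap (fun v h => M.coact_act v h)]

theorem coact_mem_cotensor (M : YDModule k (C.alg X X)) (x : M.carrier ⊗[k] C.alg X Y)
    (hx : x ∈ C.cotensorSubmodule X Y M.toRightComodule) :
    (C.tensorYD X Y M).coact x ∈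
      LinearMap.range ((C.cotensorSubmodule X Y M.toRightComodule).subtype.rTensor
        (C.alg Y Y)) := by
  rw [mem_cotensor_iff] at hx
  refine range_eqLocus _ _ _ ?_
  let J : M.carrier ⊗[k] (C.alg X X ⊗[k] C.alg X Y) →ₗ[k]
      (M.carrier ⊗[k] (C.alg X X ⊗[k] C.alg X Y)) ⊗[k] C.alg Y Y :=
    (TensorProduct.assoc k _ _ _).symm.toLinearMap ∘ₗ
      ((TensorProduct.assoc k _ _ _).symm.toLinearMap ∘ₗ
        (C.comul X Y Y).toLinearMap.lTensor _).lTensor _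
  have h1 : ∀ x : M.carrier ⊗[k] C.alg X Y,
      ((TensorProduct.assoc k M.carrier (C.alg X X) (C.alg X Y)).toLinearMap ∘ₗ
        M.coact.rTensor (C.alg X Y)).rTensor (C.alg Y Y)
        ((TensorProduct.assoc k _ _ _).symm ((C.comul X Y Y).toLinearMap.lTensor _ x)) =
      J (TensorProduct.assoc k _ _ _ (M.coact.rTensor (C.alg X Y) x)) := by
    intro x
    induction x with
    | zero => simp
    | add x y hx hy => simp only [map_add, hx, hy]
    | tmul v a =>
      simp only [LinearMap.lTensor_tmul, LinearMap.rTensor_tmul]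
      have : ∀ t : C.alg X Y ⊗[k] C.alg Y Y,
          ((TensorProduct.assoc k M.carrier (C.alg X X) (C.alg X Y)).toLinearMap ∘ₗ
            M.coact.rTensor (C.alg X Y)).rTensor (C.alg Y Y)
            ((TensorProduct.assoc k _ _ _).symm (v ⊗ₜ t)) =
          (TensorProduct.assoc k _ _ _).symm
            ((TensorProduct.assoc k _ _ _).symm.toLinearMap.lTensor _
              (TensorProduct.assoc k _ _ _ (M.coact v ⊗ₜ t))) := by
        intro t
        induction t with
        | zero => simp
        | add x y hx hy => simp only [map_add, TensorProduct.tmul_add, hx, hy]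
        | tmul a b =>
          simp only [TensorProduct.assoc_symm_tmul, LinearMap.rTensor_tmul, LinearMap.comp_apply,
            LinearEquiv.coe_coe]
          generalize M.coact v = s
          induction s with
          | zero => simp
          | add x y hx hy => simp only [map_add, TensorProduct.add_tmul, hx, hy]
          | tmul u h => simp
      rw [this]
      generalize M.coact v = s
      induction s with
      | zero => simp
      | add x y hx hy => simp only [map_add, TensorProduct.add_tmul, hx, hy]
      | tmul u h => simp [J]
  have h2 : ∀ x : M.carrier ⊗[k] C.alg X Y,
      ((C.comul X X Y).toLinearMap.lTensor M.carrier).rTensor (C.alg Y Y)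
        ((TensorProduct.assoc k _ _ _).symm ((C.comul X Y Y).toLinearMap.lTensor _ x)) =
      J ((C.comul X X Y).toLinearMap.lTensor M.carrier x) := by
    intro x
    induction x with
    | zero => simp
    | add x y hx hy => simp only [map_add, hx, hy]
    | tmul v a =>
      have e : J ((C.comul X X Y).toLinearMap.lTensor M.carrier (v ⊗ₜ a)) =
          (TensorProduct.assoc k _ _ _).symm (v ⊗ₜ (TensorProduct.assoc k _ _ _).symm
            ((C.comul X Y Y).toLinearMap.lTensor _ (C.comul X X Y a))) := by
        simp [J]
      rw [e, ← C.coassoc X X Y Y a, LinearEquiv.symm_apply_apply, LinearMap.lTensor_tmul]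
      simp only [AlgHom.toLinearMap_apply]
      generalize C.comul X Y Y a = t
      induction t with
      | zero => simp
      | add x y hx hy => simp only [map_add, TensorProduct.tmul_add, hx, hy]
      | tmul a b => simp
  exact (h1 x).trans ((congrArg J hx).trans (h2 x).symm)

/-- The cotensor product of a Yetter-Drinfeld module over `C(X,X)` with `C(X,Y)`, as a
Yetter-Drinfeld submodule of `V ⊗ C(X,Y)`. -/
noncomputable def cotensorObj (M : YDModule k (C.alg X X)) : YDModule k (C.alg Y Y) :=
  (C.tensorYD X Y M).sub (C.cotensorSubmodule X Y M.toRightComodule)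
    (C.act_mem_cotensor X Y M) (C.coact_mem_cotensor X Y M)

theorem rTensor_mem_cotensor {M N : YDModule k (C.alg X X)} (f : M ⟶ N)
    (x : M.carrier ⊗[k] C.alg X Y) (hx : x ∈ C.cotensorSubmodule X Y M.toRightComodule) :
    f.lin.rTensor (C.alg X Y) x ∈ C.cotensorSubmodule X Y N.toRightComodule := by
  rw [mem_cotensor_iff] at hx ⊢
  have h1 : ∀ x : M.carrier ⊗[k] C.alg X Y,
      TensorProduct.assoc k _ _ _ (N.coact.rTensor _ (f.lin.rTensor (C.alg X Y) x)) =
      f.lin.rTensor _ (TensorProduct.assoc k _ _ _ (M.coact.rTensor _ x)) := by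
    intro x
    induction x with
    | zero => simp
    | add x y hx hy => simp only [map_add, hx, hy]
    | tmul v a =>
      simp only [LinearMap.rTensor_tmul, f.map_coact]
      generalize M.coact v = t
      induction t with
      | zero => simp
      | add x y hx hy => simp only [map_add, TensorProduct.add_tmul, hx, hy]
      | tmul v a => simp
  rw [h1, hx, ← LinearMap.comp_apply, ← LinearMap.comp_apply, LinearMap.rTensor_comp_lTensor,
    LinearMap.lTensor_comp_rTensor]

/-- The functor `- □ C(X,Y)` from Yetter-Drinfeld modules over `C(X,X)` to Yetter-Drinfeld modules
over `C(Y,Y)`. -/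
noncomputable def cotensor : YDModule k (C.alg X X) ⥤ YDModule k (C.alg Y Y) where
  obj M := C.cotensorObj X Y M
  map {M N} f :=
    { lin := (f.lin.rTensor (C.alg X Y)).restrict
        (p := C.cotensorSubmodule X Y M.toRightComodule)
        (q := C.cotensorSubmodule X Y N.toRightComodule) (C.rTensor_mem_cotensor X Y f)
      map_act := fun w b => by
        apply Subtype.ext
        have := sandwich_map M.act (C.S Y X) N.act f.lin f.lin LinearMap.id f.map_act w.1
          (C.comul₃ Y X X Y b)
        rw [TensorProduct.map_id, TensorProduct.map_id] at this
        exact this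
      map_coact := fun w => by
        apply YDModule.subtype_rTensor_injective (C.cotensorSubmodule X Y N.toRightComodule)
        refine ((C.tensorYD X Y N).rTensor_subCoact _ (C.coact_mem_cotensor X Y N) _).trans ?_
        have h1 : ∀ t : C.cotensorSubmodule X Y M.toRightComodule ⊗[k] C.alg Y Y,
            (C.cotensorSubmodule X Y N.toRightComodule).subtype.rTensor _
              (((f.lin.rTensor (C.alg X Y)).restrict (p := C.cotensorSubmodule X Y M.toRightComodule)
                (q := C.cotensorSubmodule X Y N.toRightComodule)
                (C.rTensor_mem_cotensor X Y f)).rTensor _ t) =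
            (f.lin.rTensor (C.alg X Y)).rTensor _
              ((C.cotensorSubmodule X Y M.toRightComodule).subtype.rTensor _ t) := by
          intro t
          induction t with
          | zero => simp
          | add x y hx hy => simp only [map_add, hx, hy]
          | tmul v a => simp
        refine Eq.trans ?_ (h1 _).symm
        have h2 := (C.tensorYD X Y M).rTensor_subCoact _ (C.coact_mem_cotensor X Y M) w
        refine Eq.trans ?_ (congrArg ((f.lin.rTensor (C.alg X Y)).rTensor (C.alg Y Y)) h2).symm
        exact C.tensorYD_coact_map X Y f.lin w.1 }
  map_id M := by
    apply YDModule.hom_ext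
    apply LinearMap.ext
    intro w
    apply Subtype.ext
    exact LinearMap.rTensor_id_apply _ _ w.1
  map_comp f g := by
    apply YDModule.hom_ext
    apply LinearMap.ext
    intro w
    apply Subtype.ext
    exact LinearMap.rTensor_comp_apply _ _ _ w.1

instance : (C.cotensor X Y).PreservesZeroMorphisms where
  map_zero M N := by
    apply YDModule.hom_ext
    apply LinearMap.ext
    intro w
    apply Subtype.ext
    exact LinearMap.congr_fun (LinearMap.rTensor_zero (R := k) (N := M.carrier)
      (P := N.carrier) (C.alg X Y)) w.1

end

end Cogroupoid

section Resolutions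

variable {k H : Type u} [Field k] [Ring H] [HopfAlgebra k H]

namespace YDModule

/-- `P` is relative projective: `Hom(P, -)` maps every short exact sequence
`0 → A → B → C → 0` of Yetter-Drinfeld modules that splits as a sequence of comodules
(i.e. `B → C` has an `H`-colinear section) to a short exact sequence of vector spaces. -/
def IsRelativeProjective (P : YDModule k H) : Prop :=
  ∀ (A B C : YDModule k H) (f : A ⟶ B) (g : B ⟶ C),
    Function.Injective f.lin → Function.Exact f.lin g.lin → Function.Surjective g.lin →
    (∃ s : C.carrier →ₗ[k] B.carrier,
      (∀ c, B.coact (s c) = s.rTensor H (C.coact c)) ∧ ∀ c, g.lin (s c) = c) →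
    Function.Injective (fun φ : P ⟶ A => φ ≫ f) ∧
    Function.Exact (fun φ : P ⟶ A => φ ≫ f) (fun φ : P ⟶ B => φ ≫ g) ∧
    Function.Surjective (fun φ : P ⟶ B => φ ≫ g)

/-- A relative projective Yetter-Drinfeld module is finitely generated if it is a direct summand
(a retract) of a free Yetter-Drinfeld module `V ⊠ H` with `V` finite dimensional. -/
def IsFinitelyGeneratedRelativeProjective (P : YDModule k H) : Prop :=
  P.IsRelativeProjective ∧
    ∃ V : RightComodule k H, FiniteDimensional k V.carrier ∧ Nonempty (Retract P (free V))

/-- A relative projective Yetter-Drinfeld module resolution of `M`. -/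
def IsRelativeProjectiveResolution (P : ChainComplex (YDModule k H) ℕ) (M : YDModule k H) : Prop :=
  (∀ i, (P.X i).IsRelativeProjective) ∧
    (∀ i, Function.Exact (P.d (i + 2) (i + 1)).lin (P.d (i + 1) i).lin) ∧
    ∃ ε : P.X 0 ⟶ M, Function.Exact (P.d 1 0).lin ε.lin ∧ Function.Surjective ε.lin

/-- A complex is bounded if its terms vanish from some degree on. -/
def IsBounded (P : ChainComplex (YDModule k H) ℕ) : Prop :=
  ∃ n : ℕ, ∀ i, n ≤ i → Limits.IsZero (P.X i)

end YDModule

end Resolutions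

end YetterDrinfeld

/-! Write F for `- □ C(X,Y)` and G for `- □ C(Y,X)`. Everything rests on one natural retraction.
Since C(X,Y) is nonzero, it carries a linear functional θ with θ(1) = 1. For a comodule V, the map v
⊗ a ↦ θ(S(v₍₂₎) a) v₍₀₎ ⊗ v₍₁₎ from V ⊗ C(X,Y) to V □ C(X,Y) (`retraction`) is the identity on the
cotensor product: there the coaction of V may be traded for the comultiplication of a, and the
formula becomes θ(S(a₂) a₃) v ⊗ a₁ = v ⊗ a.

The retraction is natural in V, so on underlying vector spaces F is a natural direct summand of `- ⊗
C(X,Y)` and inherits its exactness (`cotensorMap_exact`, `cotensorMap_surjective`). For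
finite-dimensional V only finitely many first tensor factors occur in its values, so V □ C(X,Y) is
finite-dimensional. The same contraction against θ inverts the canonical map V → (V □ C(X,Y)) □
C(Y,X) (`unit_bijective`). That map is a morphism of Yetter-Drinfeld modules, so F and G are inverse
to each other up to natural isomorphism.

The assertions follow. G preserves short exact sequences and their colinear splittings, so a lifting
problem for FP becomes one for P (`isRelativeProjective_cotensor`). On the trivial comodule the
retraction takes values in the line spanned by 1 ⊗ 1, whence Fk ≅ k (`trivialHom_bijective`). For
finite generation, F(V ⊠ C(X,X)) is a retract of (V □ C(X,Y)) ⊠ C(Y,Y) (`nonempty_retract_free`).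
Boundedness holds because F preserves zero objects. -/

namespace YetterDrinfeld

/-! ### Subspaces of a tensor factor: flatness over a field -/

section TensorCodRestrict

variable {k : Type*} [Field k] {E B V : Type*} [AddCommGroup E] [Module k E] [AddCommGroup B]
  [Module k B] [AddCommGroup V] [Module k V]

/-- A linear map to `E ⊗ B` whose values lie in (the image of) `W ⊗ B`, as a map to `W ⊗ B`. -/
noncomputable def tensorCodRestrict (W : Submodule k E) (T : V →ₗ[k] E ⊗[k] B)
    (h : ∀ v, T v ∈ LinearMap.range (W.subtype.rTensor B)) : V →ₗ[k] W ⊗[k] B :=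
  (LinearEquiv.ofInjective _ (YDModule.subtype_rTensor_injective W)).symm.toLinearMap ∘ₗ
    T.codRestrict _ h

theorem rTensor_tensorCodRestrict (W : Submodule k E) (T : V →ₗ[k] E ⊗[k] B)
    (h : ∀ v, T v ∈ LinearMap.range (W.subtype.rTensor B)) (v : V) :
    W.subtype.rTensor B (tensorCodRestrict W T h v) = T v :=
  congrArg Subtype.val (LinearEquiv.apply_symm_apply (LinearEquiv.ofInjective
    (W.subtype.rTensor B) (YDModule.subtype_rTensor_injective W)) (T.codRestrict _ h v))

theorem rTensor_subtype_codRestrict (W : Submodule k E) (f : V →ₗ[k] E) (h : ∀ v, f v ∈ W)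
    (x : V ⊗[k] B) :
    W.subtype.rTensor B ((f.codRestrict W h).rTensor B x) = f.rTensor B x := by
  rw [← LinearMap.rTensor_comp_apply, LinearMap.subtype_comp_codRestrict]

theorem rTensor_injective {f : V →ₗ[k] E} (hf : Function.Injective f) :
    Function.Injective (f.rTensor B) :=
  Module.Flat.rTensor_preserves_injective_linearMap _ hf

end TensorCodRestrict

/-! ### Comultiplying the right tensor factor -/

section Rearrange

variable {k : Type*} [Field k] {A B D E H V W : Type*} [AddCommGroup A] [Module k A]
  [AddCommGroup B] [Module k B] [AddCommGroup D] [Module k D] [AddCommGroup E] [Module k E]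
  [AddCommGroup H] [Module k H] [AddCommGroup V] [Module k V] [AddCommGroup W] [Module k W]

/-- `v ⊗ h ↦ v ⊗ d(h)`, bracketed to the left. -/
noncomputable def splitRight (V : Type*) [AddCommGroup V] [Module k V] (d : H →ₗ[k] A ⊗[k] B) :
    V ⊗[k] H →ₗ[k] (V ⊗[k] A) ⊗[k] B :=
  (TensorProduct.assoc k V A B).symm.toLinearMap ∘ₗ d.lTensor V

theorem splitRight_tmul (d : H →ₗ[k] A ⊗[k] B) (v : V) (h : H) :
    splitRight V d (v ⊗ₜ h) = (TensorProduct.assoc k V A B).symm (v ⊗ₜ d h) := by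
  simp [splitRight]

theorem assoc_splitRight (d : H →ₗ[k] A ⊗[k] B) (x : V ⊗[k] H) :
    TensorProduct.assoc k V A B (splitRight V d x) = d.lTensor V x := by
  simp [splitRight]

theorem splitRight_rTensor (d : H →ₗ[k] A ⊗[k] B) (f : V →ₗ[k] W) (x : V ⊗[k] H) :
    splitRight W d (f.rTensor H x) = (f.rTensor A).rTensor B (splitRight V d x) := by
  induction x with
  | zero => simp
  | add x y hx hy => simp only [map_add, hx, hy]
  | tmul v h =>
    simp only [LinearMap.rTensor_tmul, splitRight_tmul]
    generalize d h = t
    induction t with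
    | zero => simp
    | add x y hx hy => simp only [map_add, TensorProduct.tmul_add, hx, hy]
    | tmul a b => simp

/-- Coassociativity with a spectator V. The four maps are independent so that every instance of the
cogroupoid's coassociativity fits. -/
theorem splitRight_splitRight (d₁ : H →ₗ[k] A ⊗[k] E) (d₂ : E →ₗ[k] B ⊗[k] D)
    (e₁ : H →ₗ[k] W ⊗[k] D) (e₂ : W →ₗ[k] A ⊗[k] B)
    (h : ∀ a, TensorProduct.assoc k A B D (e₂.rTensor D (e₁ a)) = d₂.lTensor A (d₁ a))
    (x : V ⊗[k] H) :
    splitRight (V ⊗[k] A) d₂ (splitRight V d₁ x) =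
      (splitRight V e₂).rTensor D (splitRight V e₁ x) := by
  induction x with
  | zero => simp
  | add x y hx hy => simp only [map_add, hx, hy]
  | tmul v a =>
    have h1 : ∀ t : A ⊗[k] E, splitRight (V ⊗[k] A) d₂ ((TensorProduct.assoc k V A E).symm
        (v ⊗ₜ t)) = (TensorProduct.assoc k (V ⊗[k] A) B D).symm
          ((TensorProduct.assoc k V A (B ⊗[k] D)).symm (v ⊗ₜ d₂.lTensor A t)) := by
      intro t
      induction t with
      | zero => simp
      | add x y hx hy => simp only [map_add, TensorProduct.tmul_add, hx, hy]
      | tmul a b => simp [splitRight_tmul]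
    have h2 : ∀ t : W ⊗[k] D, (splitRight V e₂).rTensor D ((TensorProduct.assoc k V W D).symm
        (v ⊗ₜ t)) = (TensorProduct.assoc k (V ⊗[k] A) B D).symm
          ((TensorProduct.assoc k V A (B ⊗[k] D)).symm
            (v ⊗ₜ TensorProduct.assoc k A B D (e₂.rTensor D t))) := by
      intro t
      induction t with
      | zero => simp
      | add x y hx hy => simp only [map_add, TensorProduct.tmul_add, hx, hy]
      | tmul a b =>
        simp only [TensorProduct.assoc_symm_tmul, LinearMap.rTensor_tmul, splitRight_tmul]
        generalize e₂ a = s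
        induction s with
        | zero => simp
        | add x y hx hy => simp only [map_add, TensorProduct.tmul_add, TensorProduct.add_tmul, hx, hy]
        | tmul a b => simp
    rw [splitRight_tmul, splitRight_tmul, h1, h2, h]

end Rearrange

/-- A linear map between comodules is colinear if it commutes with the coactions. -/
def IsColinear {k H : Type u} [Field k] [Ring H] [HopfAlgebra k H] (V W : RightComodule k H)
    (f : V.carrier →ₗ[k] W.carrier) : Prop :=
  ∀ v, W.coact (f v) = f.rTensor H (V.coact v)

/-! ### Cotensor products of comodules and the unit map -/

namespace Cogroupoid

variable {k : Type u} [Field k] {Ob : Type*} (C : Cogroupoid k Ob)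

variable {X Y Z : Ob} (V : RightComodule k (C.alg X X))

variable {V} in
theorem mem_cotensor_iff_splitRight {x : V.carrier ⊗[k] C.alg X Y} :
    x ∈ C.cotensorSubmodule X Y V ↔
      V.coact.rTensor (C.alg X Y) x = splitRight V.carrier (C.comul X X Y).toLinearMap x := by
  rw [mem_cotensor_iff, ← assoc_splitRight]
  exact (TensorProduct.assoc k _ _ _).injective.eq_iff

/-- Tensoring with C(Y,Z) is exact and so preserves the equalizer defining V □ C(X,Y). It remains to
check the equalizer equation in the first two factors, which is the equation for y combined with
coassociativity. -/
theorem splitRight_mem (y : V.carrier ⊗[k] C.alg X Z) (hy : y ∈ C.cotensorSubmodule X Z V) :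
    splitRight V.carrier (C.comul X Y Z).toLinearMap y ∈
      LinearMap.range ((C.cotensorSubmodule X Y V).subtype.rTensor (C.alg Y Z)) := by
  refine range_eqLocus _ _ _ ?_
  rw [mem_cotensor_iff_splitRight] at hy
  rw [LinearMap.rTensor_comp_apply, ← splitRight_rTensor, hy,
    splitRight_splitRight (C.comul X X Z).toLinearMap (C.comul X Y Z).toLinearMap
    (C.comul X Y Z).toLinearMap (C.comul X X Y).toLinearMap (C.coassoc X X Y Z),
    ← LinearMap.rTensor_comp_apply]
  congr 2
  ext1
  ext v a
  simp [splitRight_tmul]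

/-- The comultiplication `V □ C(X,Z) → (V □ C(X,Y)) ⊗ C(Y,Z)`. -/
noncomputable def cotensorComul (X Y Z : Ob) (V : RightComodule k (C.alg X X)) :
    C.cotensorSubmodule X Z V →ₗ[k] C.cotensorSubmodule X Y V ⊗[k] C.alg Y Z :=
  tensorCodRestrict _
    (splitRight V.carrier (C.comul X Y Z).toLinearMap ∘ₗ (C.cotensorSubmodule X Z V).subtype)
    (fun v => C.splitRight_mem (Y := Y) V v.1 v.2)

theorem rTensor_cotensorComul (x : C.cotensorSubmodule X Z V) :
    (C.cotensorSubmodule X Y V).subtype.rTensor (C.alg Y Z) (C.cotensorComul X Y Z V x) =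
      splitRight V.carrier (C.comul X Y Z).toLinearMap x :=
  rTensor_tensorCodRestrict _ _ _ x

/-- Everything embeds in tensor products with V, where this is coassociativity of the cogroupoid.
With Z = Y it says that comultiplying lands in an iterated cotensor product, which is how the unit
obtains its target. -/
theorem cotensorComul_coassoc (W : Ob) (x : C.cotensorSubmodule X W V) :
    TensorProduct.assoc k _ _ _ ((C.cotensorComul X Y Z V).rTensor (C.alg Z W)
        (C.cotensorComul X Z W V x)) =
      (C.comul Y Z W).toLinearMap.lTensor _ (C.cotensorComul X Y W V x) := by
  rw [← assoc_splitRight]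
  congr 1
  apply rTensor_injective (rTensor_injective (C.cotensorSubmodule X Y V).injective_subtype)
  rw [← splitRight_rTensor, rTensor_cotensorComul,
    splitRight_splitRight (C.comul X Y W).toLinearMap (C.comul Y Z W).toLinearMap
      (C.comul X Z W).toLinearMap (C.comul X Y Z).toLinearMap (C.coassoc X Y Z W),
    ← C.rTensor_cotensorComul V x, ← LinearMap.rTensor_comp_apply, ← LinearMap.rTensor_comp_apply]
  congr 2
  ext1 y
  exact C.rTensor_cotensorComul V y

theorem cotensorComul_counit (x : C.cotensorSubmodule X Y V) :
    TensorProduct.rid k _ ((C.counit Y).toLinearMap.lTensor _ (C.cotensorComul X Y Y V x)) = x := by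
  have h1 : ∀ t : C.cotensorSubmodule X Y V ⊗[k] C.alg Y Y,
      (TensorProduct.rid k _ ((C.counit Y).toLinearMap.lTensor _ t)).1 =
      TensorProduct.rid k _ ((C.counit Y).toLinearMap.lTensor _
        ((C.cotensorSubmodule X Y V).subtype.rTensor _ t)) := by
    intro t
    induction t with
    | zero => simp
    | add x y hx hy => simp only [map_add, Submodule.coe_add, hx, hy]
    | tmul a b => simp
  apply Subtype.ext
  rw [h1, rTensor_cotensorComul]
  generalize x.1 = x
  induction x with
  | zero => simp
  | add x y hx hy => simp only [map_add, hx, hy]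
  | tmul v a =>
    refine Eq.trans ?_ (congrArg (fun z => v ⊗ₜ[k] z) (C.comul_counit X Y a))
    rw [splitRight_tmul, AlgHom.toLinearMap_apply]
    generalize C.comul X Y Y a = t
    induction t with
    | zero => simp
    | add x y hx hy => simp only [map_add, TensorProduct.tmul_add, hx, hy]
    | tmul a b => simp

/-- The comodule `V □ C(X,Y)` over `C(Y,Y)`. -/
noncomputable def cotensorComodule (X Y : Ob) (V : RightComodule k (C.alg X X)) :
    RightComodule k (C.alg Y Y) where
  carrier := C.cotensorSubmodule X Y V
  coact := C.cotensorComul X Y Y V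
  coact_coassoc := C.cotensorComul_coassoc V Y
  coact_counit := C.cotensorComul_counit V

theorem coact_mem_cotensorSubmodule (v : V.carrier) : V.coact v ∈ C.cotensorSubmodule X X V :=
  C.mem_cotensor_iff.mpr (V.coact_coassoc v)

/-- The coaction of `V` as a map to `V □ C(X,X)`. -/
noncomputable def coactCotensor : V.carrier →ₗ[k] C.cotensorSubmodule X X V :=
  V.coact.codRestrict _ (C.coact_mem_cotensorSubmodule V)

/-- This is the defining equation of the cotensor product: on V □ C(X,Y), coacting on V is the same
as comultiplying in C(X,Y). -/
theorem rTensor_coactCotensor (x : C.cotensorSubmodule X Y V) :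
    (C.coactCotensor V).rTensor (C.alg X Y) x = C.cotensorComul X X Y V x := by
  apply YDModule.subtype_rTensor_injective
  rw [rTensor_cotensorComul, ← C.mem_cotensor_iff_splitRight.mp x.2, ← LinearMap.rTensor_comp_apply]
  rfl

/-- The map `V → (V □ C(X,Y)) ⊗ C(Y,X)`, `v ↦ v₍₀₎ ⊗ v₍₁₎ ⊗ v₍₂₎`. -/
noncomputable def coact₂ (Y : Ob) (V : RightComodule k (C.alg X X)) :
    V.carrier →ₗ[k] C.cotensorSubmodule X Y V ⊗[k] C.alg Y X :=
  C.cotensorComul X Y X V ∘ₗ C.coactCotensor V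

theorem rTensor_coact₂ (v : V.carrier) :
    (C.cotensorSubmodule X Y V).subtype.rTensor (C.alg Y X) (C.coact₂ Y V v) =
      splitRight V.carrier (C.comul X Y X).toLinearMap (V.coact v) :=
  C.rTensor_cotensorComul V _

/-- On an element v ⊗ a of the cotensor product both sides read v ⊗ a₁ ⊗ a₂ ⊗ a₃. The adjacent
factors a₂ and a₃ can then be cancelled by the antipode; this is what makes `retraction` a
retraction. -/
theorem rTensor_coact₂_cotensor (x : C.cotensorSubmodule X Y V) :
    (C.coact₂ Y V).rTensor (C.alg X Y) x =
      splitRight _ (C.comul Y X Y).toLinearMap (C.cotensorComul X Y Y V x) := by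
  apply (TensorProduct.assoc k _ _ _).injective
  rw [assoc_splitRight, ← cotensorComul_coassoc, coact₂, LinearMap.rTensor_comp_apply,
    rTensor_coactCotensor]

theorem coact₂_mem (v : V.carrier) :
    C.coact₂ Y V v ∈ C.cotensorSubmodule Y X (C.cotensorComodule X Y V) :=
  C.mem_cotensor_iff.mpr (C.cotensorComul_coassoc V X _)

/-- The unit `V → (V □ C(X,Y)) □ C(Y,X)`. -/
noncomputable def unit (Y : Ob) (V : RightComodule k (C.alg X X)) :
    V.carrier →ₗ[k] (C.cotensorComodule Y X (C.cotensorComodule X Y V)).carrier :=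
  (C.coact₂ Y V).codRestrict _ (C.coact₂_mem V)

theorem unit_isColinear : IsColinear V (C.cotensorComodule Y X (C.cotensorComodule X Y V))
    (C.unit Y V) := by
  intro v
  apply YDModule.subtype_rTensor_injective
  refine (C.rTensor_cotensorComul (C.cotensorComodule X Y V) _).trans ?_
  apply (TensorProduct.assoc k _ _ _).injective
  rw [assoc_splitRight]
  refine (C.cotensorComul_coassoc V X (C.coactCotensor V v)).symm.trans ?_
  refine congrArg (TensorProduct.assoc k _ _ _) ?_
  refine Eq.trans ?_ (rTensor_subtype_codRestrict _ _ (C.coact₂_mem V) _).symm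
  rw [← rTensor_coactCotensor, ← LinearMap.rTensor_comp_apply]
  rfl

end Cogroupoid

end YetterDrinfeld

namespace YetterDrinfeld

theorem IsColinear.comp {k H : Type u} [Field k] [Ring H] [HopfAlgebra k H]
    {U V W : RightComodule k H} {f : U.carrier →ₗ[k] V.carrier} {g : V.carrier →ₗ[k] W.carrier}
    (hg : IsColinear V W g) (hf : IsColinear U V f) : IsColinear U W (g ∘ₗ f) := by
  intro v
  rw [LinearMap.comp_apply, hg, hf, LinearMap.rTensor_comp_apply]

theorem isColinear_id {k H : Type u} [Field k] [Ring H] [HopfAlgebra k H]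
    (V : RightComodule k H) : IsColinear V V LinearMap.id := fun v => by
  rw [LinearMap.rTensor_id_apply, LinearMap.id_apply]

/-! ### Consequences of connectedness -/

namespace Cogroupoid

variable {k : Type u} [Field k] {Ob : Type*} (C : Cogroupoid k Ob) {X Y : Ob}

/-- In a nonzero algebra over a field, 1 is a nonzero vector. Connectedness enters the proof only
through these functionals. -/
theorem exists_functional (hC : C.Connected) (X Y : Ob) : ∃ θ : C.alg X Y →ₗ[k] k, θ 1 = 1 := by
  have := hC X Y
  exact Module.Projective.exists_dual_eq_one k one_ne_zero

/-! ### Contraction against a functional -/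

section Contraction

variable {E F : Type*} [AddCommGroup E] [Module k E] [AddCommGroup F] [Module k F]
  (θ : C.alg X Y →ₗ[k] k)

/-- The map `e ⊗ b ⊗ a ↦ θ(S(b) a) e`. -/
noncomputable def contraction (E : Type*) [AddCommGroup E] [Module k E] :
    (E ⊗[k] C.alg Y X) ⊗[k] C.alg X Y →ₗ[k] E :=
  (TensorProduct.rid k E).toLinearMap ∘ₗ
    (θ ∘ₗ LinearMap.mul' k (C.alg X Y) ∘ₗ (C.S Y X).rTensor (C.alg X Y)).lTensor E ∘ₗ
      (TensorProduct.assoc k _ _ _).toLinearMap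

theorem contraction_tmul (e : E) (b : C.alg Y X) (a : C.alg X Y) :
    C.contraction θ E ((e ⊗ₜ b) ⊗ₜ a) = θ (C.S Y X b * a) • e := by
  simp [contraction]

theorem contraction_rTensor (f : E →ₗ[k] F) (x : (E ⊗[k] C.alg Y X) ⊗[k] C.alg X Y) :
    C.contraction θ F ((f.rTensor _).rTensor _ x) = f (C.contraction θ E x) := by
  refine LinearMap.congr_fun (f := C.contraction θ F ∘ₗ (f.rTensor _).rTensor _)
    (g := f ∘ₗ C.contraction θ E) ?_ x
  ext e b a
  simp [contraction_tmul]

/-- The antipode axiom gives θ(S(b₁) b₂) = ε(b) θ(1) = ε(b). -/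
theorem contraction_splitRight (hθ : θ 1 = 1) (x : E ⊗[k] C.alg Y Y) :
    C.contraction θ E (splitRight E (C.comul Y X Y).toLinearMap x) =
      TensorProduct.rid k E ((C.counit Y).toLinearMap.lTensor E x) := by
  have h : (θ ∘ₗ LinearMap.mul' k (C.alg X Y) ∘ₗ (C.S Y X).rTensor (C.alg X Y)) ∘ₗ
      (C.comul Y X Y).toLinearMap = (C.counit Y).toLinearMap := by
    ext b
    have := congrArg θ (C.S_mul Y X b)
    simpa [Algebra.algebraMap_eq_smul_one, hθ] using this
  rw [← h, LinearMap.lTensor_comp_apply, ← assoc_splitRight]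
  rfl

/-- The images under T of a finite basis involve finitely many vectors of E. Contraction only
rescales the E-factor, so its values stay in their span. -/
theorem exists_finite_forall_contraction_mem [FiniteDimensional k F]
    (T : F →ₗ[k] E ⊗[k] C.alg Y X) : ∃ W : Submodule k E, Module.Finite k W ∧
      ∀ t, C.contraction θ E (T.rTensor (C.alg X Y) t) ∈ W := by
  let b := Module.finBasis k F
  obtain ⟨W, hW, h⟩ := TensorProduct.exists_finite_submodule_left_of_setFinite
    (Set.range fun i => T (b i)) (Set.finite_range _)
  refine ⟨W, hW, fun t => ?_⟩
  induction t with
  | zero => simp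
  | add x y hx hy => rw [map_add, map_add]; exact W.add_mem hx hy
  | tmul v a =>
    have hv : T v ∈ LinearMap.range (W.subtype.rTensor (C.alg Y X)) := by
      rw [← b.sum_repr v, map_sum]
      refine Submodule.sum_mem _ fun i _ => ?_
      rw [map_smul]
      exact Submodule.smul_mem _ _ (h ⟨i, rfl⟩)
    obtain ⟨z, hz⟩ := hv
    rw [LinearMap.rTensor_tmul, ← hz, ← LinearMap.rTensor_tmul, contraction_rTensor]
    exact Subtype.prop _

end Contraction

/-! ### The retraction onto the cotensor product -/

section Retraction

variable (θ : C.alg X Y →ₗ[k] k) (V : RightComodule k (C.alg X X))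

/-- The map `V ⊗ C(X,Y) → V □ C(X,Y)`, `v ⊗ a ↦ θ(S(v₍₂₎) a) v₍₀₎ ⊗ v₍₁₎`. -/
noncomputable def retraction : V.carrier ⊗[k] C.alg X Y →ₗ[k] C.cotensorSubmodule X Y V :=
  C.contraction θ _ ∘ₗ (C.coact₂ Y V).rTensor (C.alg X Y)

theorem retraction_apply (hθ : θ 1 = 1) (x : C.cotensorSubmodule X Y V) :
    C.retraction θ V x = x := by
  rw [retraction, LinearMap.comp_apply, rTensor_coact₂_cotensor, contraction_splitRight _ _ hθ,
    cotensorComul_counit]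

/-- A cotensor product of a finite-dimensional comodule with `C(X,Y)` is finite-dimensional. -/
theorem finiteDimensional_cotensor (hθ : θ 1 = 1) [FiniteDimensional k V.carrier] :
    FiniteDimensional k (C.cotensorSubmodule X Y V) := by
  obtain ⟨W, hW, h⟩ := C.exists_finite_forall_contraction_mem θ (C.coact₂ Y V)
  -- The retraction fixes V □ C(X,Y) pointwise, so its values, all in W, exhaust that space.
  have h3 : W = ⊤ := by
    rw [Submodule.eq_top_iff']
    intro x
    rw [← C.retraction_apply θ V hθ x]
    exact h _
  rw [h3] at hW
  exact Module.Finite.equiv Submodule.topEquiv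

end Retraction

/-! ### Functoriality and exactness on comodules -/

section Map

variable {V W : RightComodule k (C.alg X X)} (f : V.carrier →ₗ[k] W.carrier)
  (hf : IsColinear V W f)

theorem rTensor_mem {Z : Ob} {f : V.carrier →ₗ[k] W.carrier} (hf : IsColinear V W f)
    (x : V.carrier ⊗[k] C.alg X Z) (hx : x ∈ C.cotensorSubmodule X Z V) :
    f.rTensor (C.alg X Z) x ∈ C.cotensorSubmodule X Z W := by
  rw [mem_cotensor_iff_splitRight] at hx ⊢
  rw [splitRight_rTensor, ← hx, ← LinearMap.rTensor_comp_apply, ← LinearMap.rTensor_comp_apply]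
  congr 2
  ext1 v
  exact hf v

/-- The map `V □ C(X,Z) → W □ C(X,Z)` induced by a colinear map `V → W`. -/
noncomputable def cotensorMap (Z : Ob) :
    C.cotensorSubmodule X Z V →ₗ[k] C.cotensorSubmodule X Z W :=
  (f.rTensor (C.alg X Z)).restrict (C.rTensor_mem hf)

theorem cotensorComul_map (Y Z : Ob) (x : C.cotensorSubmodule X Z V) :
    C.cotensorComul X Y Z W (C.cotensorMap f hf Z x) =
      (C.cotensorMap f hf Y).rTensor _ (C.cotensorComul X Y Z V x) := by
  apply YDModule.subtype_rTensor_injective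
  rw [rTensor_cotensorComul, ← LinearMap.rTensor_comp_apply]
  change splitRight W.carrier _ (f.rTensor _ x.1) =
    (f.rTensor (C.alg X Y) ∘ₗ (C.cotensorSubmodule X Y V).subtype).rTensor _ _
  rw [splitRight_rTensor, LinearMap.rTensor_comp_apply, rTensor_cotensorComul]

theorem cotensorMap_isColinear : IsColinear (C.cotensorComodule X Y V)
    (C.cotensorComodule X Y W) (C.cotensorMap f hf Y) :=
  C.cotensorComul_map f hf Y Y

theorem coact₂_map (v : V.carrier) :
    C.coact₂ Y W (f v) = (C.cotensorMap f hf Y).rTensor _ (C.coact₂ Y V v) := by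
  rw [coact₂, coact₂, LinearMap.comp_apply, LinearMap.comp_apply, ← cotensorComul_map]
  congr 1
  exact Subtype.ext (hf v)

theorem unit_map (v : V.carrier) :
    C.unit Y W (f v) = C.cotensorMap (C.cotensorMap f hf Y) (C.cotensorMap_isColinear f hf) X
      (C.unit Y V v) :=
  Subtype.ext (C.coact₂_map f hf v)

/-- Naturality of the retraction in the comodule, for a fixed θ. It moves preimages found in V ⊗
C(X,Y) into V □ C(X,Y). -/
theorem retraction_map (θ : C.alg X Y →ₗ[k] k) (x : V.carrier ⊗[k] C.alg X Y) :
    C.retraction θ W (f.rTensor _ x) = C.cotensorMap f hf Y (C.retraction θ V x) := by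
  rw [retraction, retraction, LinearMap.comp_apply, LinearMap.comp_apply, ← contraction_rTensor,
    ← LinearMap.rTensor_comp_apply, ← LinearMap.rTensor_comp_apply]
  congr 3
  ext1 v
  exact C.coact₂_map f hf v

theorem cotensorMap_injective (h : Function.Injective f) :
    Function.Injective (C.cotensorMap f hf Y) := fun _ _ e =>
  Subtype.ext (rTensor_injective h (congrArg Subtype.val e))

/-- Lift in the full tensor product, then retract: by naturality the retracted lift still maps to x,
because the retraction fixes x. -/
theorem cotensorMap_surjective (hC : C.Connected) (h : Function.Surjective f) :
    Function.Surjective (C.cotensorMap f hf Y) := by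
  obtain ⟨θ, hθ⟩ := C.exists_functional hC X Y
  intro x
  obtain ⟨y, hy⟩ := LinearMap.rTensor_surjective (C.alg X Y) h x.1
  exact ⟨C.retraction θ V y, by rw [← retraction_map, hy, C.retraction_apply θ W hθ]⟩

theorem cotensorMap_exact (hC : C.Connected) {U : RightComodule k (C.alg X X)}
    (g : W.carrier →ₗ[k] U.carrier) (hg : IsColinear W U g) (h : Function.Exact f g) :
    Function.Exact (C.cotensorMap f hf Y) (C.cotensorMap g hg Y) := by
  obtain ⟨θ, hθ⟩ := C.exists_functional hC X Y
  have e := Module.Flat.rTensor_exact (C.alg X Y) h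
  intro x
  constructor
  · intro hx
    obtain ⟨y, hy⟩ := (e x.1).mp (congrArg Subtype.val hx)
    exact ⟨C.retraction θ V y, by rw [← retraction_map, hy, C.retraction_apply θ W hθ]⟩
  · rintro ⟨y, rfl⟩
    exact Subtype.ext ((e _).mpr ⟨y.1, rfl⟩)

theorem cotensorMap_comp_apply {U : RightComodule k (C.alg X X)}
    {g : W.carrier →ₗ[k] U.carrier} (hg : IsColinear W U g) {h : V.carrier →ₗ[k] U.carrier}
    (hh : IsColinear V U h) (e : ∀ v, g (f v) = h v) (x : C.cotensorSubmodule X Y V) :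
    C.cotensorMap g hg Y (C.cotensorMap f hf Y x) = C.cotensorMap h hh Y x := by
  apply Subtype.ext
  change g.rTensor _ (f.rTensor _ x.1) = h.rTensor _ x.1
  rw [← LinearMap.rTensor_comp_apply, (LinearMap.ext e : g ∘ₗ f = h)]

theorem cotensorMap_id_apply (hid : IsColinear V V LinearMap.id) (x : C.cotensorSubmodule X Y V) :
    C.cotensorMap LinearMap.id hid Y x = x :=
  Subtype.ext (LinearMap.rTensor_id_apply _ _ x.1)

end Map

/-- The inverse sends v ⊗ b ⊗ a to θ(S(b) a) v, where θ is now a functional on C(Y,X). -/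
theorem unit_bijective (hC : C.Connected) (Y : Ob) (V : RightComodule k (C.alg X X)) :
    Function.Bijective (C.unit Y V) := by
  obtain ⟨θ, hθ⟩ := C.exists_functional hC Y X
  constructor
  · apply Function.LeftInverse.injective (g := fun w => C.contraction θ V.carrier
      ((C.cotensorSubmodule X Y V).subtype.rTensor (C.alg Y X) w.1))
    intro v
    refine (congrArg _ (C.rTensor_coact₂ V v)).trans ?_
    -- The composite sends v to θ(S(v₍₁₎) v₍₂₎) v₍₀₎ = ε(v₍₁₎) v₍₀₎.
    rw [contraction_splitRight _ _ hθ]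
    exact V.coact_counit v
  -- On V □ C(X,Y) the double coaction through X is the unit of V applied to the first factor. By
  -- naturality of contraction, the retraction onto (V □ C(X,Y)) □ C(Y,X) therefore factors through
  -- the unit, and it fixes every w.
  · have h : ∀ x : C.cotensorSubmodule X Y V,
        C.coact₂ X (C.cotensorComodule X Y V) x = (C.unit Y V).rTensor _ x.1 := by
      intro x
      apply YDModule.subtype_rTensor_injective
      refine (C.rTensor_coact₂ (C.cotensorComodule X Y V) x).trans ?_
      refine Eq.trans ?_ (rTensor_subtype_codRestrict _ _ (C.coact₂_mem V) _).symm
      exact (C.rTensor_coact₂_cotensor V x).symm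
    have h2 : ∀ t : C.cotensorSubmodule X Y V ⊗[k] C.alg Y X,
        C.retraction θ (C.cotensorComodule X Y V) t = C.unit Y V (C.contraction θ V.carrier
          ((C.cotensorSubmodule X Y V).subtype.rTensor (C.alg Y X) t)) := by
      intro t
      rw [← contraction_rTensor, ← LinearMap.rTensor_comp_apply]
      refine congrArg (C.contraction θ _) (LinearMap.congr_fun (congrArg _ ?_) t)
      ext1 x
      exact h x
    intro w
    exact ⟨_, (h2 w.1).symm.trans (C.retraction_apply θ (C.cotensorComodule X Y V) hθ w)⟩

end Cogroupoid

end YetterDrinfeld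

namespace YetterDrinfeld

/-! ### Morphisms of Yetter-Drinfeld modules and the universal property of free ones -/

namespace YDModule

variable {k H : Type u} [Field k] [Ring H] [HopfAlgebra k H]

/-- The inverse of a bijective morphism of Yetter-Drinfeld modules. -/
noncomputable def homInv {M N : YDModule k H} (f : M ⟶ N) (hf : Function.Bijective f.lin) :
    N ⟶ M where
  lin := (LinearEquiv.ofBijective f.lin hf).symm.toLinearMap
  map_act v h := by
    apply hf.1
    obtain ⟨w, rfl⟩ := hf.2 v
    have e : ∀ w, (LinearEquiv.ofBijective f.lin hf).symm (f.lin w) = w :=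
      (LinearEquiv.ofBijective f.lin hf).symm_apply_apply
    rw [LinearEquiv.coe_coe, e, ← f.map_act, e]
  map_coact v := by
    obtain ⟨w, rfl⟩ := hf.2 v
    have e : (LinearEquiv.ofBijective f.lin hf).symm.toLinearMap ∘ₗ f.lin = LinearMap.id :=
      LinearMap.ext (LinearEquiv.ofBijective f.lin hf).symm_apply_apply
    rw [f.map_coact, ← LinearMap.rTensor_comp_apply, ← LinearMap.comp_apply, e]
    simp

theorem isIso_of_bijective {M N : YDModule k H} (f : M ⟶ N) (hf : Function.Bijective f.lin) :
    IsIso f :=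
  ⟨homInv f hf, hom_ext (LinearMap.ext (LinearEquiv.ofBijective f.lin hf).symm_apply_apply),
    hom_ext (LinearMap.ext (LinearEquiv.ofBijective f.lin hf).apply_symm_apply)⟩

/-- A morphism killed by g takes values in the image of the injective f and factors linearly through
it. The factor is linear over H and colinear because f, and f tensored with H, are injective.
Relative projectivity thus reduces to surjectivity. -/
theorem hom_left_exact (P : YDModule k H) {A B C : YDModule k H} (f : A ⟶ B) (g : B ⟶ C)
    (hf : Function.Injective f.lin) (h : Function.Exact f.lin g.lin) :
    Function.Injective (fun φ : P ⟶ A => φ ≫ f) ∧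
      Function.Exact (fun φ : P ⟶ A => φ ≫ f) (fun φ : P ⟶ B => φ ≫ g) := by
  refine ⟨fun φ ψ e => hom_ext (LinearMap.ext fun v => hf ?_), fun φ => ⟨fun e => ?_, ?_⟩⟩
  · exact LinearMap.congr_fun (congrArg Hom.lin e) v
  · have hr : ∀ v, φ.lin v ∈ LinearMap.range f.lin := fun v =>
      (h _).mp (LinearMap.congr_fun (congrArg Hom.lin e) v)
    let l : P.carrier →ₗ[k] A.carrier :=
      (LinearEquiv.ofInjective f.lin hf).symm.toLinearMap ∘ₗ φ.lin.codRestrict _ hr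
    have hl : ∀ v, f.lin (l v) = φ.lin v := fun v => congrArg Subtype.val
      ((LinearEquiv.ofInjective f.lin hf).apply_symm_apply (φ.lin.codRestrict _ hr v))
    have hl' : f.lin ∘ₗ l = φ.lin := LinearMap.ext hl
    refine ⟨⟨l, fun v a => hf ?_, fun v => rTensor_injective hf ?_⟩, hom_ext hl'⟩
    · rw [hl, f.map_act, hl, φ.map_act]
    · rw [← f.map_coact, hl, ← LinearMap.rTensor_comp_apply, hl', φ.map_coact]
  · rintro ⟨ψ, rfl⟩
    apply hom_ext
    refine LinearMap.ext fun v => ?_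
    exact (h _).mpr ⟨_, rfl⟩

theorem lift_act_mul (V : Type*) [AddCommGroup V] [Module k V] (N : YDModule k H)
    (f : V →ₗ[k] N.carrier) (x : V ⊗[k] H) (h : H) :
    TensorProduct.lift (N.act ∘ₗ f) ((LinearMap.mulRight k h).lTensor V x) =
      N.act (TensorProduct.lift (N.act ∘ₗ f) x) h := by
  induction x with
  | zero => simp
  | add x y hx hy => simp only [map_add, LinearMap.add_apply, hx, hy]
  | tmul v g => simp [N.act_mul]

/-- The coaction of the free module copies the Yetter-Drinfeld condition, so this is that condition
in N, evaluated at f(v). -/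
theorem coact_lift_act (V : RightComodule k H) (N : YDModule k H)
    (f : V.carrier →ₗ[k] N.carrier) (hf : IsColinear V N.toRightComodule f)
    (x : V.carrier ⊗[k] H) : N.coact (TensorProduct.lift (N.act ∘ₗ f) x) =
      (TensorProduct.lift (N.act ∘ₗ f)).rTensor H (freeCoact V x) := by
  induction x with
  | zero => simp
  | add x y hx hy => simp only [map_add, hx, hy]
  | tmul v g =>
    rw [freeCoact_tmul, sandwich_map (TensorProduct.mk k V.carrier H) _ N.act f
      (TensorProduct.lift (N.act ∘ₗ f)) LinearMap.id (by intros; simp), ← hf v]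
    simpa using N.coact_act (f v) g

/-- The morphism `V ⊠ H → N`, `v ⊗ h ↦ f(v) · h` induced by a colinear map `f : V → N`. -/
noncomputable def freeLift (V : RightComodule k H) (N : YDModule k H)
    (f : V.carrier →ₗ[k] N.carrier) (hf : IsColinear V N.toRightComodule f) : free V ⟶ N where
  lin := TensorProduct.lift (N.act ∘ₗ f)
  map_act := lift_act_mul V.carrier N f
  map_coact := coact_lift_act V N f hf

/-- The colinear map `V → V ⊠ H`, `v ↦ v ⊗ 1`. -/
noncomputable def freeUnit (V : RightComodule k H) : V.carrier →ₗ[k] (free V).carrier :=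
  (TensorProduct.mk k V.carrier H).flip 1

theorem freeUnit_isColinear (V : RightComodule k H) :
    IsColinear V (free V).toRightComodule (freeUnit V) := by
  intro v
  refine (freeCoact_tmul V v 1).trans ?_
  have h1 : comul₃ k H 1 = 1 := by simp [comul₃, Algebra.TensorProduct.one_def]
  have h2 : ∀ t, sandwich (TensorProduct.mk k V.carrier H) (HopfAlgebra.antipode k (A := H)) t 1 =
      ((TensorProduct.mk k V.carrier H).flip 1).rTensor H t := by
    intro t
    induction t with
    | zero => simp
    | add x y hx hy => simp only [map_add, LinearMap.add_apply, hx, hy]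
    | tmul v a => simp [Algebra.TensorProduct.one_def]
  rw [h1]
  exact h2 _

theorem freeLift_freeUnit (V : RightComodule k H) (N : YDModule k H)
    (f : V.carrier →ₗ[k] N.carrier) (hf : IsColinear V N.toRightComodule f) (v : V.carrier) :
    (freeLift V N f hf).lin (freeUnit V v) = f v := by
  change TensorProduct.lift (N.act ∘ₗ f) (v ⊗ₜ 1) = f v
  simp [N.act_one]

/-- The vectors v ⊗ 1 generate the free module, since v ⊗ a = (v ⊗ 1) · a. -/
theorem free_hom_ext {V : RightComodule k H} {N : YDModule k H} {f g : free V ⟶ N}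
    (h : ∀ v, f.lin (freeUnit V v) = g.lin (freeUnit V v)) : f = g := by
  apply hom_ext
  refine TensorProduct.ext' fun v a => ?_
  have e : (v ⊗ₜ[k] a : V.carrier ⊗[k] H) = (free V).act (freeUnit V v) a := by
    change _ = (LinearMap.mulRight k a).lTensor V.carrier (v ⊗ₜ 1)
    simp
  rw [e]
  exact (f.map_act _ _).trans ((congrArg (fun w => N.act w a) (h v)).trans (g.map_act _ _).symm)

end YDModule

/-! ### The inverse functors on Yetter-Drinfeld modules -/

namespace Cogroupoid

variable {k : Type u} [Field k] {Ob : Type*} (C : Cogroupoid k Ob) (X Y : Ob)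

open YDModule

/-- This is the linearity of the unit over C(X,X). Comultiplying S(h₁) v₍₁₎ h₃ splits it into outer
factors belonging to C(Y,X) and inner ones belonging to C(X,Y); `five` and Δ(S(h)) = S(h₂) ⊗ S(h₁)
identify the inner part with the action on M □ C(X,Y). -/
theorem coact₂_act (M : YDModule k (C.alg X X)) (v : M.carrier) (h : C.alg X X) :
    C.coact₂ Y M.toRightComodule (M.act v h) =
      sandwich (C.cotensorObj X Y M).act (C.S X Y) (C.coact₂ Y M.toRightComodule v)
        (C.comul₃ X Y Y X h) := by
  apply YDModule.subtype_rTensor_injective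
  have e := sandwich_map (C.cotensorObj X Y M).act (C.S X Y) (sandwich M.act (C.S Y X))
    (C.cotensorSubmodule X Y M.toRightComodule).subtype
    (C.cotensorSubmodule X Y M.toRightComodule).subtype (C.comul₃ Y X X Y).toLinearMap
    (fun w b => rfl) (C.coact₂ Y M.toRightComodule v)
    (C.comul₃ X Y Y X h)
  refine Eq.trans ?_ (e.trans (congrArg (fun t => sandwich (sandwich M.act (C.S Y X)) (C.S X Y) t
    _) (C.rTensor_coact₂ M.toRightComodule v))).symm
  rw [rTensor_coact₂, M.coact_act, ← C.five X Y X X Y X h]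
  exact sandwich_comul M.act (C.S X X) (C.comul X Y X) (C.comul X Y X).toLinearMap
    (C.S X Y) (C.S Y X) (C.comul_S X Y X) _ _

/-- The unit `M → (M □ C(X,Y)) □ C(Y,X)` as a morphism of Yetter-Drinfeld modules. -/
noncomputable def unitHom (M : YDModule k (C.alg X X)) :
    M ⟶ (C.cotensor Y X).obj ((C.cotensor X Y).obj M) where
  lin := C.unit Y M.toRightComodule
  map_act v h := Subtype.ext (C.coact₂_act X Y M v h)
  map_coact := C.unit_isColinear M.toRightComodule

theorem unitHom_naturality {M N : YDModule k (C.alg X X)} (f : M ⟶ N) :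
    f ≫ C.unitHom X Y N = C.unitHom X Y M ≫ (C.cotensor Y X).map ((C.cotensor X Y).map f) :=
  hom_ext (LinearMap.ext fun v => C.unit_map (Y := Y) f.lin f.map_coact v)

theorem isIso_unitHom (hC : C.Connected) (M : YDModule k (C.alg X X)) : IsIso (C.unitHom X Y M) :=
  isIso_of_bijective _ (C.unit_bijective hC Y M.toRightComodule)

theorem inv_unitHom_comp [∀ M, IsIso (C.unitHom X Y M)] {M N : YDModule k (C.alg X X)}
    (f : M ⟶ N) : inv (C.unitHom X Y M) ≫ f =
      (C.cotensor Y X).map ((C.cotensor X Y).map f) ≫ inv (C.unitHom X Y N) := by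
  rw [IsIso.inv_comp_eq, ← Category.assoc, ← unitHom_naturality, Category.assoc,
    IsIso.hom_inv_id, Category.comp_id]

/-- The functor `- □ C(X,Y)` preserves relative projectives. -/
theorem isRelativeProjective_cotensor (hC : C.Connected) {P : YDModule k (C.alg X X)}
    (hP : P.IsRelativeProjective) : ((C.cotensor X Y).obj P).IsRelativeProjective := by
  intro A B D f g hf hfg hg ⟨s, hs, hgs⟩
  obtain ⟨h1, h2⟩ := hom_left_exact ((C.cotensor X Y).obj P) f g hf hfg
  -- Left exactness is automatic; only the lifting of φ through g needs P.
  refine ⟨h1, h2, fun φ => ?_⟩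
  have := C.isIso_unitHom X Y hC
  have := C.isIso_unitHom Y X hC
  obtain ⟨-, -, h3⟩ := hP _ _ _ ((C.cotensor Y X).map f) ((C.cotensor Y X).map g)
    (C.cotensorMap_injective _ f.map_coact hf)
    (C.cotensorMap_exact _ f.map_coact hC _ g.map_coact hfg)
    (C.cotensorMap_surjective _ g.map_coact hC hg)
    -- The section s is only colinear, so it is transported by the comodule-level map and not by the
    -- functor.
    ⟨C.cotensorMap s hs X, C.cotensorMap_isColinear s hs, fun c =>
      (C.cotensorMap_comp_apply s hs g.map_coact (isColinear_id D.toRightComodule) hgs c).trans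
        (C.cotensorMap_id_apply (isColinear_id D.toRightComodule) c)⟩
  -- The unit of FP and F applied to the unit of P are two isomorphisms FP → FGFP. Precomposing φ
  -- with the automorphism of FP that compares them makes the final composite equal φ without a
  -- triangle identity.
  obtain ⟨ψ, hψ⟩ := h3 (C.unitHom X Y P ≫ (C.cotensor Y X).map
    (C.unitHom Y X _ ≫ inv ((C.cotensor X Y).map (C.unitHom X Y P)) ≫ φ))
  refine ⟨(C.cotensor X Y).map ψ ≫ inv (C.unitHom Y X B), ?_⟩
  dsimp only at hψ ⊢
  rw [Category.assoc, inv_unitHom_comp, ← Category.assoc, ← Functor.map_comp, hψ, Functor.map_comp,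
    Category.assoc, ← inv_unitHom_comp, IsIso.inv_hom_id_assoc, IsIso.hom_inv_id_assoc]

theorem tmul_one_mem_cotensor (c : k) : c ⊗ₜ[k] (1 : C.alg X Y) ∈
    C.cotensorSubmodule X Y (trivial k (C.alg X X)).toRightComodule := by
  refine C.mem_cotensor_iff.mpr ?_
  change TensorProduct.assoc k _ _ _ ((c ⊗ₜ[k] 1) ⊗ₜ[k] 1) = c ⊗ₜ[k] (C.comul X X Y 1)
  simp [Algebra.TensorProduct.one_def]

/-- The middle factor acts through the counit and disappears, leaving S(b₁) b₂ = ε(b). This gives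
the linearity of `trivialHom`. -/
theorem sandwich_counit (c : k) (b : C.alg Y Y) :
    sandwich ((LinearMap.mul k k).compl₂ (C.counit X).toLinearMap) (C.S Y X)
      (c ⊗ₜ[k] (1 : C.alg X Y)) (C.comul₃ Y X X Y b) = (c * C.counit Y b) ⊗ₜ[k] 1 := by
  have key : ∀ t : C.alg Y X ⊗[k] (C.alg X X ⊗[k] C.alg X Y),
      sandwich ((LinearMap.mul k k).compl₂ (C.counit X).toLinearMap) (C.S Y X) (c ⊗ₜ[k] 1) t =
        c ⊗ₜ[k] LinearMap.mul' k (C.alg X Y) ((C.S Y X).rTensor (C.alg X Y)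
          (((TensorProduct.lid k (C.alg X Y)).toLinearMap ∘ₗ
            (C.counit X).toLinearMap.rTensor (C.alg X Y)).lTensor _ t)) := by
    intro t
    induction t with
    | zero => simp
    | add x y hx hy => simp only [map_add, TensorProduct.tmul_add, hx, hy]
    | tmul a t =>
      induction t with
      | zero => simp
      | add x y hx hy => simp only [map_add, TensorProduct.tmul_add, hx, hy]
      | tmul b d => simp [TensorProduct.smul_tmul', mul_comm]
  have h2 : ((TensorProduct.lid k (C.alg X Y)).toLinearMap ∘ₗ
      (C.counit X).toLinearMap.rTensor (C.alg X Y)) ∘ₗ (C.comul X X Y).toLinearMap =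
      LinearMap.id := LinearMap.ext (C.counit_comul X Y)
  rw [key, comul₃_apply, ← LinearMap.lTensor_comp_apply, h2, LinearMap.lTensor_id_apply,
    C.S_mul, Algebra.algebraMap_eq_smul_one, ← TensorProduct.smul_tmul, smul_eq_mul, mul_comm]

/-- The morphism `k → k □ C(X,Y)`, `1 ↦ 1 ⊗ 1`. -/
noncomputable def trivialHom :
    trivial k (C.alg Y Y) ⟶ (C.cotensor X Y).obj (trivial k (C.alg X X)) where
  lin := LinearMap.codRestrict (C.cotensorSubmodule X Y (trivial k (C.alg X X)).toRightComodule)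
    ((TensorProduct.mk k k (C.alg X Y)).flip 1) (C.tmul_one_mem_cotensor X Y)
  map_act c b := Subtype.ext (C.sandwich_counit X Y c b).symm
  map_coact c := by
    apply YDModule.subtype_rTensor_injective
    refine (C.rTensor_cotensorComul _ _).trans ?_
    refine Eq.trans ?_ (rTensor_subtype_codRestrict _ _ (C.tmul_one_mem_cotensor X Y) _).symm
    have h : ∀ c : k, splitRight k (C.comul X Y Y).toLinearMap (c ⊗ₜ[k] 1) =
        ((TensorProduct.mk k k (C.alg X Y)).flip 1).rTensor (C.alg Y Y) (c ⊗ₜ[k] 1) := by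
      simp [splitRight_tmul, Algebra.TensorProduct.one_def]
    exact h c

theorem coact₂_trivial (c : k) : C.coact₂ Y (trivial k (C.alg X X)).toRightComodule c =
    (⟨c ⊗ₜ[k] 1, C.tmul_one_mem_cotensor X Y c⟩ :
      C.cotensorSubmodule X Y (trivial k (C.alg X X)).toRightComodule) ⊗ₜ[k] 1 := by
  apply YDModule.subtype_rTensor_injective
  refine (C.rTensor_coact₂ _ _).trans ?_
  have h : splitRight k (C.comul X Y X).toLinearMap (c ⊗ₜ[k] 1) = (c ⊗ₜ[k] 1) ⊗ₜ[k] 1 := by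
    simp [splitRight_tmul, Algebra.TensorProduct.one_def]
  exact h

/-- By `coact₂_trivial`, the retraction sends c ⊗ a to θ(S(1) a) c ⊗ 1 = θ(a) c ⊗ 1. Its image,
which is all of k □ C(X,Y), is therefore the line spanned by 1 ⊗ 1; applying θ to the second factor
recovers c. -/
theorem trivialHom_bijective (hC : C.Connected) : Function.Bijective (C.trivialHom X Y).lin := by
  obtain ⟨θ, hθ⟩ := C.exists_functional hC X Y
  constructor
  · apply Function.LeftInverse.injective (g := fun w => TensorProduct.rid k k (θ.lTensor k w.1))
    have h : ∀ c : k, TensorProduct.rid k k (θ.lTensor k (c ⊗ₜ[k] 1)) = c := by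
      simp [hθ]
    exact h
  · have h : ∀ t : k ⊗[k] C.alg X Y,
        C.retraction θ (trivial k (C.alg X X)).toRightComodule t =
          (C.trivialHom X Y).lin (TensorProduct.rid k k (θ.lTensor k t)) := by
      refine LinearMap.congr_fun (f := C.retraction θ (trivial k (C.alg X X)).toRightComodule)
        (g := (C.trivialHom X Y).lin ∘ₗ (TensorProduct.rid k k).toLinearMap ∘ₗ θ.lTensor k)
        (TensorProduct.ext' fun c a => ?_)
      refine (congrArg (fun y => C.contraction θ _ (y ⊗ₜ a)) (C.coact₂_trivial X Y c)).trans ?_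
      refine (C.contraction_tmul θ _ _ _).trans ?_
      rw [C.S_one, one_mul]
      refine ((C.trivialHom X Y).lin.map_smul (θ a) c).symm.trans ?_
      refine congrArg (C.trivialHom X Y).lin ?_
      have e : ∀ c : k, θ a • c = TensorProduct.rid k k (θ.lTensor k (c ⊗ₜ a)) := by simp
      exact e c
    intro w
    exact ⟨_, (h w.1).symm.trans
      (C.retraction_apply θ (trivial k (C.alg X X)).toRightComodule hθ w)⟩

/-- The module `(V ⊠ C(X,X)) □ C(X,Y)` is a retract of `(V □ C(X,Y)) ⊠ C(Y,Y)`. -/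
theorem nonempty_retract_free (hC : C.Connected) (V : RightComodule k (C.alg X X)) :
    Nonempty (Retract ((C.cotensor X Y).obj (free V)) (free (C.cotensorComodule X Y V))) := by
  have := C.isIso_unitHom X Y hC
  have := C.isIso_unitHom Y X hC
  let W := C.cotensorComodule X Y V
  let Φ : free W ⟶ (C.cotensor X Y).obj (free V) :=
    freeLift W _ (C.cotensorMap (freeUnit V) (freeUnit_isColinear V) Y)
      (C.cotensorMap_isColinear (freeUnit V) (freeUnit_isColinear V))
  let ψ : free V ⟶ (C.cotensor Y X).obj (free W) :=
    freeLift V _ (C.cotensorMap (freeUnit W) (freeUnit_isColinear W) X ∘ₗ C.unit Y V)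
      ((C.cotensorMap_isColinear (freeUnit W) (freeUnit_isColinear W)).comp
        (C.unit_isColinear V))
  -- Both sides are morphisms out of a free module, so they are compared on the generators v ⊗ 1,
  -- where the equality is naturality of the unit along v ↦ v ⊗ 1.
  have h : ψ ≫ (C.cotensor Y X).map Φ = C.unitHom X Y (free V) := by
    apply free_hom_ext
    intro v
    refine (congrArg ((C.cotensor Y X).map Φ).lin (freeLift_freeUnit V _ _ _ v)).trans ?_
    refine Eq.trans ?_ (C.unit_map (freeUnit V) (freeUnit_isColinear V) v).symm
    exact C.cotensorMap_comp_apply (freeUnit W) (freeUnit_isColinear W) Φ.map_coact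
      (C.cotensorMap_isColinear (freeUnit V) (freeUnit_isColinear V))
      (freeLift_freeUnit W _ _ _) (C.unit Y V v)
  let Ψ := (C.cotensor X Y).map ψ ≫ inv (C.unitHom Y X (free W))
  have h2 : Ψ ≫ Φ = (C.cotensor X Y).map (C.unitHom X Y (free V)) ≫ inv (C.unitHom Y X _) := by
    rw [← h, Functor.map_comp, Category.assoc, Category.assoc, inv_unitHom_comp]
  -- An isomorphism suffices, with no need for the identity: correcting Ψ by its inverse gives a
  -- section of Φ.
  have : IsIso (Ψ ≫ Φ) := by rw [h2]; infer_instance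
  exact ⟨⟨inv (Ψ ≫ Φ) ≫ Ψ, Φ, by rw [Category.assoc, IsIso.inv_hom_id]⟩⟩

end Cogroupoid

end YetterDrinfeld

theorem lemma2p10 {k : Type u} [Field k] {Ob : Type*} (C : YetterDrinfeld.Cogroupoid k Ob)
    (hC : C.Connected) (X Y : Ob)
    (P : ChainComplex (YetterDrinfeld.YDModule k (C.alg X X)) ℕ)
    (hP : YetterDrinfeld.YDModule.IsRelativeProjectiveResolution P
      (YetterDrinfeld.YDModule.trivial k (C.alg X X))) :
    YetterDrinfeld.YDModule.IsRelativeProjectiveResolution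
        (((C.cotensor X Y).mapHomologicalComplex (ComplexShape.down ℕ)).obj P)
        (YetterDrinfeld.YDModule.trivial k (C.alg Y Y)) ∧
      ((∀ i, (P.X i).IsFinitelyGeneratedRelativeProjective) →
        ∀ i, ((((C.cotensor X Y).mapHomologicalComplex (ComplexShape.down ℕ)).obj
          P).X i).IsFinitelyGeneratedRelativeProjective) ∧
      (YetterDrinfeld.YDModule.IsBounded P →
        YetterDrinfeld.YDModule.IsBounded
          (((C.cotensor X Y).mapHomologicalComplex (ComplexShape.down ℕ)).obj P)) := by
  obtain ⟨h1, h2, ε, h3, h4⟩ := hP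
  have exact_map : ∀ {L M N : YetterDrinfeld.YDModule k (C.alg X X)} (f : L ⟶ M) (g : M ⟶ N),
      Function.Exact f.lin g.lin →
      Function.Exact ((C.cotensor X Y).map f).lin ((C.cotensor X Y).map g).lin :=
    fun f g h => C.cotensorMap_exact f.lin f.map_coact hC g.lin g.map_coact h
  have hj := C.trivialHom_bijective X Y hC
  let e := LinearEquiv.ofBijective (C.trivialHom X Y).lin hj
  -- The new augmentation is Fε followed by the identification of Fk with k; postcomposing with an
  -- isomorphism changes neither the kernel nor surjectivity.
  refine ⟨⟨fun i => C.isRelativeProjective_cotensor X Y hC (h1 i),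
    fun i => exact_map _ _ (h2 i),
    (C.cotensor X Y).map ε ≫ YetterDrinfeld.YDModule.homInv (C.trivialHom X Y) hj, ?_, ?_⟩, ?_, ?_⟩
  · intro x
    exact (e.symm.map_eq_zero_iff).trans (exact_map _ _ h3 x)
  · exact e.symm.surjective.comp (C.cotensorMap_surjective ε.lin ε.map_coact hC h4)
  · intro h i
    obtain ⟨hi, V, hV, ⟨r⟩⟩ := h i
    obtain ⟨θ, hθ⟩ := C.exists_functional hC X Y
    obtain ⟨s⟩ := C.nonempty_retract_free X Y hC V
    -- The retract of V ⊠ C(X,X) is sent by F to a retract of F(V ⊠ C(X,X)), itself a retract of a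
    -- free module on the finite-dimensional V □ C(X,Y).
    exact ⟨C.isRelativeProjective_cotensor X Y hC hi, C.cotensorComodule X Y V,
      C.finiteDimensional_cotensor θ V hθ, ⟨(r.map (C.cotensor X Y)).trans s⟩⟩
  · rintro ⟨n, hn⟩
    exact ⟨n, fun i hi => (C.cotensor X Y).map_isZero (hn i hi)⟩
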